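/- Let $(\Omega,\mathcal F,P)$ be a probability space with a filtration $(\mathcal F_t)_{0\le t\le T}$ such that $\mathcal F_0$ contains all $P$-zero sets of $\mathcal F$, let $(S_t)_{0\le t\le T}$ be an adapted $\mathbb R^d$-valued process and $\Delta S_t=S_t-S_{t-1}$. Let $\Xi_t$ be the set of $\mathcal F_t$-measurable $\mathbb R^d$-valued random variables. Conditional expectations are generalized ones, $E(X|\mathcal H)=E(X^+|\mathcal H)-E(X^-|\mathcal H)\in[-\infty,\infty]$, well defined when a.s. the two terms are not both infinite; likewise $EX=EX^+-EX^-$. Let $U:\mathbb R\to\mathbb R$ be concave and nondecreasing with $U(0)=0$, and let $\tilde x>0$ and $0<\gamma<1$ be such that $U(\lambda x)\le\lambda^\gamma U(x)$ for all $x\ge\tilde x$ and $\lambda\ge1$. Assume absence of arbitrage: if $\phi_t\in\Xi_{t-1}$ for $1\le t\le T$ and $\sum_{t=1}^T\langle\phi_t,\Delta S_t\rangle\ge0$ a.s., then $\sum_{t=1}^T\langle\phi_t,\Delta S_t\rangle=0$ a.s. The dynamic value functions are given by $U_T(x)=U(x)$ and, for $0\le t<T$ and $x\in\mathbb R$, $$U_t(x)=\operatorname*{ess\,sup}_{\xi\in\Xi_t}E\big(U_{t+1}(x+\langle\xi,\Delta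 S_{t+1}\rangle)\,\big|\,\mathcal F_t\big).$$ Here $U_{t+1}$ on the right-hand side is a regular version, that is, a finite random function which is $\mathcal F_{t+1}$-measurable for each fixed $x$ and whose paths are a.s. nondecreasing and concave in $x$ (such a version is unique up to indistinguishability). Assume that these functions are well defined and finite from above: for every $0\le t<T$ and every choice of regular versions of $U_{t+1},\dots,U_T$, for all $x\in\mathbb R$, the conditional expectation above is well defined for every $\xi\in\Xi_t$ and $U_t(x)<\infty$ a.s.; moreover $EU_0(x)<\infty$ for all $x\in\mathbb R$ (for every choice of regular versions). Then there is a constant $C>0$ such that, for all $x\in\mathbb R$ and $\lambda\ge1$, $$U(\lambda x)\le\lambda U(x)+C\lambda^\gamma,\qquad U(\lambda x)\le\lambda^\gamma U(x)+C\lambda^\gamma,\tag{G}$$ and the value functions $U_t$, $0\le t\le T$, have finite versions, $\mathcal F_t$-measurable for each $x$, such that: 1. for each $t$, almost surely, $x\mapsto U_t(x)$ is nondecreasing and concave; 2. for every $C>0$ for which $U$ satisfies (G) and for each $t$, almost surely, $U_t(\lambda x)\le\lambda U_t(x)+C\lambda^\gamma$ and $U_t(\lambda x)\le\lambda^\gamma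 U_t(x)+C\lambda^\gamma$ for all $x\in\mathbb R$ and $\lambda\ge1$; 3. $EU_t(x)>-\infty$ and $U_t(x)<\infty$ for all $x\in\mathbb R$ and $0\le t\le T$; 4. there are $\mathcal B(\mathbb R)\otimes\mathcal F_t$-measurable functions $\tilde\xi_{t+1}:\mathbb R\times\Omega\to\mathbb R^d$, $0\le t<T$, such that for every $x\in\mathbb R$, a.s., $$U_t(x)=E\big(U_{t+1}(x+\langle\tilde\xi_{t+1}(x),\Delta S_{t+1}\rangle)\,\big|\,\mathcal F_t\big),$$ so that one function $\tilde\xi_{t+1}$ attains the essential supremum in the recursion for all $x$. -/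

import Mathlib

open MeasureTheory Filter
open scoped ENNReal

noncomputable section

namespace UtilityMax

/-- The utility function `U : ℝ → ℝ` is concave, nondecreasing, `U 0 = 0`, and
`U (l * x) ≤ l ^ γ * U x` for all `x ≥ xt` and `l ≥ 1`, where `xt > 0` and `0 < γ < 1`. -/
structure IsUtility (U : ℝ → ℝ) (xt γ : ℝ) : Prop where
  concave : ConcaveOn ℝ Set.univ U
  mono : Monotone U
  zero : U 0 = 0
  xt_pos : 0 < xt
  γ_pos : 0 < γ
  γ_lt_one : γ < 1
  elasticity : ∀ x, xt ≤ x → ∀ l : ℝ, 1 ≤ l → U (l * x) ≤ l ^ γ * U x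

/-- The two growth inequalities with exponent `γ` and constant `C`. -/
def Growth (γ C : ℝ) (V : ℝ → ℝ) : Prop :=
  ∀ x l : ℝ, 1 ≤ l → V (l * x) ≤ l * V x + C * l ^ γ ∧ V (l * x) ≤ l ^ γ * V x + C * l ^ γ

variable {Ω : Type*}

/-- Extended expectation `E X = E X⁺ - E X⁻` of a real random variable, with values in `[-∞, ∞]`.
In `EReal` one has `∞ - ∞ = -∞`, so that `-∞ < eExp P X` holds exactly when `E X⁻ < ∞`. -/
def eExp [MeasurableSpace Ω] (P : Measure Ω) (X : Ω → ℝ) : EReal :=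
  ((∫⁻ ω, ENNReal.ofReal (X ω) ∂P : ℝ≥0∞) : EReal)
    - ((∫⁻ ω, ENNReal.ofReal (-X ω) ∂P : ℝ≥0∞) : EReal)

/-- Generalized conditional expectation `E(X|m) = E(X⁺|m) - E(X⁻|m)`, with values in `[-∞, ∞]`,
built from conditional expectations of nonnegative random variables (which always exist). -/
def genCondExp {mΩ : MeasurableSpace Ω} (m : MeasurableSpace Ω) (P : Measure[mΩ] Ω)
    (X : Ω → ℝ) : Ω → EReal := fun ω =>
  ((condLExp m P (fun ω' => ENNReal.ofReal (X ω')) ω : ℝ≥0∞) : EReal)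
    - ((condLExp m P (fun ω' => ENNReal.ofReal (-X ω')) ω : ℝ≥0∞) : EReal)

/-- The generalized conditional expectation is well defined: almost surely, `E(X⁺|m)` and
`E(X⁻|m)` are not both infinite. -/
def GenCondExpWellDefined {mΩ : MeasurableSpace Ω} (m : MeasurableSpace Ω) (P : Measure[mΩ] Ω)
    (X : Ω → ℝ) : Prop :=
  ∀ᵐ ω ∂P, condLExp m P (fun ω' => ENNReal.ofReal (X ω')) ω < ∞ ∨
    condLExp m P (fun ω' => ENNReal.ofReal (-X ω')) ω < ∞

/-- `G` is (a version of) the essential supremum of the family `f` of extended random variables: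
the almost surely least random variable dominating every member of the family almost surely. -/
structure IsEssSupFamily [MeasurableSpace Ω] (P : Measure Ω) {ι : Type*} (f : ι → Ω → EReal)
    (G : Ω → EReal) : Prop where
  measurable : Measurable G
  le : ∀ i, f i ≤ᵐ[P] G
  least : ∀ H : Ω → EReal, Measurable H → (∀ i, f i ≤ᵐ[P] H) → G ≤ᵐ[P] H

variable {d : ℕ}

/-- Value at time `t` of the portfolio `φ` with initial capital `c`, for the price process `S`:
`c + ∑_{i=1}^t ⟨φ_i, S_i - S_{i-1}⟩`. -/
def portfolioValue (S : ℕ → Ω → EuclideanSpace ℝ (Fin d)) (c : ℝ)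
    (φ : ℕ → Ω → EuclideanSpace ℝ (Fin d)) (t : ℕ) (ω : Ω) : ℝ :=
  c + ∑ i ∈ Finset.range t, inner ℝ (φ (i + 1) ω) (S (i + 1) ω - S i ω)

/-- Absence of arbitrage up to time `T`, over all predictable strategies `φ_1, …, φ_T`
(`φ_t` is `ℱ_{t-1}`-measurable). -/
def NoArbitrage [mΩ : MeasurableSpace Ω] (P : Measure Ω) (ℱ : Filtration ℕ mΩ)
    (S : ℕ → Ω → EuclideanSpace ℝ (Fin d)) (T : ℕ) : Prop :=
  ∀ φ : ℕ → Ω → EuclideanSpace ℝ (Fin d), (∀ t < T, Measurable[ℱ t] (φ (t + 1))) →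
    (∀ᵐ ω ∂P, 0 ≤ portfolioValue S 0 φ T ω) → ∀ᵐ ω ∂P, portfolioValue S 0 φ T ω = 0

/-- For a random function `V` (the value function of time `t + 1`), the random variable
`ω ↦ V(x + ⟨ξ(ω), S_{t+1}(ω) - S_t(ω)⟩, ω)`. -/
def nextValue (S : ℕ → Ω → EuclideanSpace ℝ (Fin d)) (t : ℕ) (V : ℝ → Ω → ℝ) (x : ℝ)
    (ξ : Ω → EuclideanSpace ℝ (Fin d)) (ω : Ω) : ℝ :=
  V (x + inner ℝ (ξ ω) (S (t + 1) ω - S t ω)) ω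

/-- `G` is a version of `ess sup_ξ E(V(x + ⟨ξ, ΔS_{t+1}⟩) | ℱ_t)`, where `ξ` ranges over all
`ℱ_t`-measurable `d`-dimensional random variables. -/
def IsBellmanSup [mΩ : MeasurableSpace Ω] (P : Measure Ω) (ℱ : Filtration ℕ mΩ)
    (S : ℕ → Ω → EuclideanSpace ℝ (Fin d)) (t : ℕ) (V : ℝ → Ω → ℝ) (x : ℝ)
    (G : Ω → EReal) : Prop :=
  IsEssSupFamily P
    (fun ξ : {ξ : Ω → EuclideanSpace ℝ (Fin d) // Measurable[ℱ t] ξ} =>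
      genCondExp (ℱ t) P (nextValue S t V x ξ.1)) G

/-- `u_s, …, u_T` are regular versions of the dynamic value functions `U_s, …, U_T`.
Each `u_t` is a finite random function, `u_t(x)` is `ℱ_t`-measurable for every `x`, almost every
path of `u_t` is nondecreasing and concave, `u_T = U`, and for `s ≤ t < T` and every `x`, `u_t(x)`
is a version of `ess sup_ξ E(u_{t+1}(x + ⟨ξ, ΔS_{t+1}⟩) | ℱ_t)`.

The recursion evaluates the random function of time `t + 1` at a random point, so it is meaningful
only once a regular version of that function has been fixed. Versions with nondecreasing concave,
hence continuous, paths are unique up to indistinguishability. -/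
structure IsRegularValue [mΩ : MeasurableSpace Ω] (P : Measure Ω) (ℱ : Filtration ℕ mΩ)
    (S : ℕ → Ω → EuclideanSpace ℝ (Fin d)) (T : ℕ) (U : ℝ → ℝ) (s : ℕ)
    (u : ℕ → ℝ → Ω → ℝ) : Prop where
  terminal : ∀ x ω, u T x ω = U x
  adapted : ∀ t, s ≤ t → t ≤ T → ∀ x, Measurable[ℱ t] (u t x)
  mono : ∀ t, s ≤ t → t ≤ T → ∀ᵐ ω ∂P, Monotone (fun x => u t x ω)
  concave : ∀ t, s ≤ t → t ≤ T → ∀ᵐ ω ∂P, ConcaveOn ℝ Set.univ (fun x => u t x ω)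
  bellman : ∀ t, s ≤ t → t < T → ∀ x,
    IsBellmanSup P ℱ S t (u (t + 1)) x (fun ω => (u t x ω : EReal))

/-- The value functions are well defined and finite from above: going backwards from `T`, once
regular versions of `U_{t+1}, …, U_T` are fixed (no matter which ones), all the conditional
expectations in the definition of `U_t(x)` are well defined and `U_t(x)`, their essential
supremum, is almost surely `< ∞`, for every `x`; finally `E U_0(x) < ∞` for every `x`. -/
structure ValueWellPosed [mΩ : MeasurableSpace Ω] (P : Measure Ω) (ℱ : Filtration ℕ mΩ)
    (S : ℕ → Ω → EuclideanSpace ℝ (Fin d)) (T : ℕ) (U : ℝ → ℝ) : Prop where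
  wellDefined : ∀ t < T, ∀ u, IsRegularValue P ℱ S T U (t + 1) u → ∀ x,
    ∀ ξ : Ω → EuclideanSpace ℝ (Fin d), Measurable[ℱ t] ξ →
      GenCondExpWellDefined (ℱ t) P (nextValue S t (u (t + 1)) x ξ)
  lt_top : ∀ t < T, ∀ u, IsRegularValue P ℱ S T U (t + 1) u → ∀ x,
    ∀ G : Ω → EReal, IsBellmanSup P ℱ S t (u (t + 1)) x G → ∀ᵐ ω ∂P, G ω < ⊤
  exp_lt_top : ∀ u, IsRegularValue P ℱ S T U 0 u → ∀ x, eExp P (u 0 x) < ⊤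

end UtilityMax

end

/-! ### Growth of the utility, extended expectations and essential suprema. -/

namespace UtilityMax

open Topology

/-! The proof is a backward induction with invariant `GoodPath`: each path of the value function is
nondecreasing, concave, above `U`, unbounded below, and inherits the growth inequalities for every
admissible `C`. The bound from below by the constant `U x` gives `E U_t(x) > -∞`. For `U` itself the
growth comes from the elasticity condition at large arguments and from concavity with `U 0 = 0` at
negative ones. If `U` vanishes identically the statement is trivial; otherwise concavity makes `U`
unbounded below.

For one step back, take a regular conditional law of the pair (path of the next value function,
price increment) given `ℱ t`. This turns the conditional problem into a family of problems under
fixed laws, `OnePeriod`, indexed by `ω`.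

The heart is `OnePeriod.coercive`. Suppose that the capital is bounded above, that the positions are
orthogonal to those without effect, that the pair tends to infinity in norm, and that expected
utility stays bounded below. At scale `L`, growth bounds the utility by `O(L ^ γ) = o(L)`, while
concave paths unbounded below fall at least linearly wherever the limit direction loses. So the
limit direction almost surely does not lose, which absence of arbitrage forbids. Hence maximizers
over large balls are global ones, and, letting the capital tend to `-∞`, the new value is again
unbounded below. The other parts of the invariant follow by comparing positions
(`OnePeriod.goodPath_value`).

Maximizers are selected measurably in the pair (capital, state), by compactness and truncation
(`exists_measurable_maximizer`, `exists_measurable_optimal`), so one function serves all `x`. -/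

theorem IsUtility.le_mul {U : ℝ → ℝ} {xt γ : ℝ} (hU : IsUtility U xt γ) {l : ℝ} (hl : 1 ≤ l)
    (x : ℝ) : U (l * x) ≤ l * U x := by
  have hl0 : 0 < l := by linarith
  have h := hU.concave.2 (Set.mem_univ (l * x)) (Set.mem_univ 0)
    (by positivity : 0 ≤ l⁻¹) (by have := inv_le_one_of_one_le₀ hl; linarith : 0 ≤ 1 - l⁻¹)
    (by ring)
  simp only [smul_eq_mul, mul_zero, add_zero, hU.zero] at h
  rwa [inv_mul_cancel_left₀ hl0.ne', inv_mul_le_iff₀ hl0] at h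

theorem IsUtility.exists_growth {U : ℝ → ℝ} {xt γ : ℝ} (hU : IsUtility U xt γ) :
    ∃ C : ℝ, 0 < C ∧ Growth γ C U := by
  have hpos : ∀ x, 0 ≤ x → 0 ≤ U x := fun x hx => hU.zero ▸ hU.mono hx
  have hxt : 0 ≤ U xt := hpos _ hU.xt_pos.le
  -- `U xt` absorbs the range `0 ≤ x ≤ xt`, where `U (l * x) ≤ U (l * xt)`; the summand `1` only
  -- makes the constant positive.
  refine ⟨U xt + 1, by linarith, fun x l hl => ?_⟩
  have hl0 : 0 < l := by linarith
  have hlg : 0 < l ^ γ := Real.rpow_pos_of_pos hl0 γ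
  refine ⟨(hU.le_mul hl x).trans (by nlinarith), ?_⟩
  rcases le_total xt x with h | h
  · exact (hU.elasticity x h l hl).trans (by nlinarith)
  rcases le_total 0 x with h0 | h0
  · calc U (l * x) ≤ U (l * xt) := hU.mono (by gcongr)
      _ ≤ l ^ γ * U xt := hU.elasticity xt le_rfl l hl
      _ ≤ l ^ γ * U x + (U xt + 1) * l ^ γ := by nlinarith [hpos x h0]
  -- Here `U x ≤ 0` and `l ^ γ ≤ l`, so the linear bound is the stronger one.
  · have hUx : U x ≤ 0 := hU.zero ▸ hU.mono h0
    have hle : l ^ γ ≤ l := by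
      simpa using Real.rpow_le_rpow_of_exponent_le hl hU.γ_lt_one.le
    have := hU.le_mul hl x
    nlinarith

variable {Θ : Type*} [MeasurableSpace Θ] {μ : Measure Θ}

theorem integrable_of_le_of_lintegral_ofReal {h k : Θ → ℝ} (hh : Integrable h μ) (hk : Measurable k)
    (hle : h ≤ᵐ[μ] k) (hfin : ∫⁻ θ, ENNReal.ofReal (k θ) ∂μ < ∞) : Integrable k μ := by
  refine ⟨hk.aestronglyMeasurable, ?_⟩
  have hb : ∫⁻ θ, (ENNReal.ofReal (k θ) + ‖h θ‖ₑ) ∂μ < ∞ := by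
    rw [lintegral_add_left hk.ennreal_ofReal]
    exact ENNReal.add_lt_top.2 ⟨hfin, hh.2⟩
  refine lt_of_le_of_lt (lintegral_mono_ae ?_) hb
  filter_upwards [hle] with θ hθ
  rw [← ofReal_norm, ← ofReal_norm]
  rcases le_total 0 (k θ) with h0 | h0
  · rw [Real.norm_of_nonneg h0]; exact le_self_add
  · refine le_trans (ENNReal.ofReal_le_ofReal ?_) le_add_self
    rw [Real.norm_of_nonpos h0]
    exact (neg_le_neg hθ).trans (neg_le_abs _)

theorem eExp_of_integrable {h : Θ → ℝ} (hh : Integrable h μ) : eExp μ h = (∫ θ, h θ ∂μ : ℝ) := by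
  have h1 : ∫⁻ θ, ENNReal.ofReal (h θ) ∂μ ≠ ∞ := hh.lintegral_lt_top.ne
  have h2 : ∫⁻ θ, ENNReal.ofReal (-h θ) ∂μ ≠ ∞ := hh.neg.lintegral_lt_top.ne
  rw [eExp, integral_eq_lintegral_pos_part_sub_lintegral_neg_part hh, EReal.coe_sub,
    EReal.coe_ennreal_toReal h1, EReal.coe_ennreal_toReal h2]

theorem eExp_eq_bot {h : Θ → ℝ} (hm : Measurable h) (hfin : ∫⁻ θ, ENNReal.ofReal (h θ) ∂μ < ∞)
    (hh : ¬ Integrable h μ) : eExp μ h = ⊥ := by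
  have h2 : ∫⁻ θ, ENNReal.ofReal (-h θ) ∂μ = ∞ := by
    by_contra hne
    refine hh ⟨hm.aestronglyMeasurable, ?_⟩
    have : ∫⁻ θ, ‖h θ‖ₑ ∂μ ≤ ∫⁻ θ, (ENNReal.ofReal (h θ) + ENNReal.ofReal (-h θ)) ∂μ := by
      refine lintegral_mono fun θ => ?_
      rw [← ofReal_norm]
      rcases le_total 0 (h θ) with h0 | h0
      · rw [Real.norm_of_nonneg h0]; exact le_self_add
      · rw [Real.norm_of_nonpos h0]; exact le_add_self
    refine lt_of_le_of_lt this ?_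
    rw [lintegral_add_left hm.ennreal_ofReal]
    exact ENNReal.add_lt_top.2 ⟨hfin, Ne.lt_top hne⟩
  rw [eExp, h2, EReal.coe_ennreal_top, EReal.sub_top]

theorem bot_lt_eExp_of_le [IsProbabilityMeasure μ] {h : Θ → ℝ} {c : ℝ} (hc : ∀ θ, c ≤ h θ) :
    ⊥ < eExp μ h := by
  have h2 : ∫⁻ θ, ENNReal.ofReal (-h θ) ∂μ ≠ ∞ := by
    have : ∫⁻ θ, ENNReal.ofReal (-h θ) ∂μ ≤ ∫⁻ _, ENNReal.ofReal (-c) ∂μ :=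
      lintegral_mono fun θ => ENNReal.ofReal_le_ofReal (neg_le_neg (hc θ))
    simp only [lintegral_const, measure_univ, mul_one] at this
    exact (this.trans_lt ENNReal.ofReal_lt_top).ne
  rw [bot_lt_iff_ne_bot, eExp, sub_eq_add_neg, Ne, EReal.add_eq_bot_iff]
  simp [h2]

theorem integrable_max_neg [IsProbabilityMeasure μ] {h : Θ → ℝ} (hm : Measurable h)
    (hfin : ∫⁻ θ, ENNReal.ofReal (h θ) ∂μ < ∞) (n : ℕ) :
    Integrable (fun θ => max (h θ) (-(n : ℝ))) μ := by
  refine integrable_of_le_of_lintegral_ofReal (integrable_const (-(n : ℝ)))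
    (hm.max measurable_const)
    (Eventually.of_forall fun θ => le_max_right _ _) (lt_of_le_of_lt (lintegral_mono fun θ => ?_)
      hfin)
  exact ENNReal.ofReal_le_ofReal_iff'.2 (by
    rcases le_total (h θ) 0 with h0 | h0
    · exact Or.inr (max_le h0 (by simp))
    · exact Or.inl (max_le le_rfl (le_trans (by simp) h0)))

/-- Fatou's lemma applied to the nonnegative differences `max h 0 - max h (-n)`, which converge to
the negative part of `h`, gives integrability; dominated convergence then passes the bound to the
limit. This recovers the true expected utility from its truncations. -/
theorem integrable_of_forall_le_integral_max [IsProbabilityMeasure μ] {h : Θ → ℝ}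
    (hm : Measurable h) (hfin : ∫⁻ θ, ENNReal.ofReal (h θ) ∂μ < ∞) {c : ℝ}
    (hc : ∀ n : ℕ, c ≤ ∫ θ, max (h θ) (-n) ∂μ) : Integrable h μ ∧ c ≤ ∫ θ, h θ ∂μ := by
  have hmeas : ∀ n : ℕ, Measurable fun θ => max (h θ) (-(n : ℝ)) := fun n =>
    hm.max measurable_const
  have hint := integrable_max_neg hm hfin
  have hpos : Integrable (fun θ => max (h θ) 0) μ := by simpa using hint 0
  have hneg : ∀ n : ℕ, ∫⁻ θ, ENNReal.ofReal (max (h θ) 0 - max (h θ) (-(n : ℝ))) ∂μ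
      ≤ ENNReal.ofReal (∫ θ, max (h θ) 0 ∂μ - c) := by
    intro n
    have hsub : ∫ θ, (max (h θ) 0 - max (h θ) (-(n : ℝ))) ∂μ
        = ∫ θ, max (h θ) 0 ∂μ - ∫ θ, max (h θ) (-(n : ℝ)) ∂μ := integral_sub hpos (hint n)
    have hlint := ofReal_integral_eq_lintegral_ofReal (hpos.sub (hint n))
      (Eventually.of_forall fun θ => sub_nonneg.2 (max_le_max le_rfl (by simp)))
    simp only [Pi.sub_apply] at hlint
    rw [← hlint, hsub]
    exact ENNReal.ofReal_le_ofReal (by linarith [hc n])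
  have hfinneg : ∫⁻ θ, ENNReal.ofReal (-h θ) ∂μ ≤ ENNReal.ofReal (∫ θ, max (h θ) 0 ∂μ - c) := by
    have hlim : ∀ θ, Tendsto (fun n : ℕ => ENNReal.ofReal (max (h θ) 0 - max (h θ) (-(n : ℝ))))
        atTop (𝓝 (ENNReal.ofReal (-h θ))) := by
      intro θ
      refine tendsto_const_nhds.congr' ?_
      obtain ⟨N, hN⟩ := exists_nat_ge (-h θ)
      filter_upwards [eventually_ge_atTop N] with n hn
      have : (N : ℝ) ≤ n := by exact_mod_cast hn
      rw [max_eq_left (by linarith : -(n : ℝ) ≤ h θ)]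
      rcases le_total (h θ) 0 with h0 | h0
      · rw [max_eq_right h0, zero_sub]
      · rw [max_eq_left h0, sub_self, ENNReal.ofReal_of_nonpos (by linarith), ENNReal.ofReal_zero]
    calc ∫⁻ θ, ENNReal.ofReal (-h θ) ∂μ
        = ∫⁻ θ, liminf (fun n : ℕ => ENNReal.ofReal (max (h θ) 0 - max (h θ) (-(n : ℝ)))) atTop ∂μ :=
          lintegral_congr fun θ => (hlim θ).liminf_eq.symm
      _ ≤ liminf (fun n : ℕ => ∫⁻ θ, ENNReal.ofReal (max (h θ) 0 - max (h θ) (-(n : ℝ))) ∂μ)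
          atTop := lintegral_liminf_le fun n =>
            ((hm.max measurable_const).sub (hmeas n)).ennreal_ofReal
      _ ≤ _ := liminf_le_of_frequently_le' (Frequently.of_forall hneg)
  have hI : Integrable h μ := by
    by_contra hh
    have hb := eExp_eq_bot hm hfin hh
    rw [eExp, sub_eq_add_neg, EReal.add_eq_bot_iff] at hb
    have : ∫⁻ θ, ENNReal.ofReal (-h θ) ∂μ ≠ ∞ := (hfinneg.trans_lt ENNReal.ofReal_lt_top).ne
    simp [this] at hb
  refine ⟨hI, ?_⟩
  have hlim : Tendsto (fun n : ℕ => ∫ θ, max (h θ) (-(n : ℝ)) ∂μ) atTop (𝓝 (∫ θ, h θ ∂μ)) := by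
    refine tendsto_integral_of_dominated_convergence (fun θ => |h θ|)
      (fun n => (hmeas n).aestronglyMeasurable) hI.abs
      (fun n => Eventually.of_forall fun θ => ?_) (Eventually.of_forall fun θ => ?_)
    · rw [Real.norm_eq_abs, abs_le]
      refine ⟨(neg_abs_le _).trans (le_max_left _ _), max_le (le_abs_self _) ?_⟩
      exact le_trans (by simp) (abs_nonneg _)
    · refine tendsto_const_nhds.congr' ?_
      obtain ⟨N, hN⟩ := exists_nat_ge (-h θ)
      filter_upwards [eventually_ge_atTop N] with n hn
      have : (N : ℝ) ≤ n := by exact_mod_cast hn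
      rw [max_eq_left (by linarith : -(n : ℝ) ≤ h θ)]
  exact ge_of_tendsto' hlim hc

/-- Exhaustion: choose a countable subfamily whose union has the largest possible measure. Adding
one more `A i` cannot enlarge that measure. -/
theorem exists_countable_ae_cover (P : Measure Θ) [IsFiniteMeasure P] {ι : Type*} {A : ι → Set Θ}
    (hA : ∀ i, MeasurableSet (A i)) :
    ∃ J : Set ι, J.Countable ∧ ∀ i, P (A i \ ⋃ j ∈ J, A j) = 0 := by
  let M : {J : Set ι // J.Countable} → ℝ≥0∞ := fun J => P (⋃ j ∈ J.1, A j)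
  obtain ⟨s, -, hs, hmem⟩ := exists_seq_tendsto_sSup
    (S := Set.range M) ⟨_, ⟨⟨∅, Set.countable_empty⟩, rfl⟩⟩ (OrderTop.bddAbove _)
  choose J hJ using hmem
  have hcount : (⋃ n, (J n).1).Countable := Set.countable_iUnion fun n => (J n).2
  refine ⟨⋃ n, (J n).1, hcount, fun i => ?_⟩
  set B : Set Θ := ⋃ j ∈ ⋃ n, (J n).1, A j with hB
  have hBm : MeasurableSet B := MeasurableSet.biUnion hcount fun j _ => hA j
  have hge : sSup (Set.range M) ≤ P B := by
    refine le_of_tendsto' hs fun n => ?_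
    rw [← hJ n]
    exact measure_mono (Set.biUnion_subset_biUnion_left (Set.subset_iUnion (fun n => (J n).1) n))
  have hle : P (A i ∪ B) ≤ sSup (Set.range M) := by
    refine le_sSup ⟨⟨insert i (⋃ n, (J n).1), hcount.insert i⟩, ?_⟩
    simp only [M, Set.biUnion_insert, hB]
  have h1 : P (A i ∪ B) = P B + P (A i \ B) := by
    rw [Set.union_comm, ← Set.union_sdiff_self, measure_union disjoint_sdiff_self_right
      ((hA i).diff hBm)]
  have h2 : P B + P (A i \ B) ≤ P B + 0 := by rw [← h1, add_zero]; exact hle.trans hge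
  exact le_antisymm ((ENNReal.add_le_add_iff_left (measure_ne_top P B)).1 h2) zero_le

/-- A countable subfamily that exhausts the superlevel sets at every rational level has a pointwise
supremum which is the essential supremum. Existence matters because the well-posedness hypothesis
only speaks of a given version. -/
theorem exists_isEssSupFamily (P : Measure Θ) [IsFiniteMeasure P] {ι : Type*}
    {f : ι → Θ → EReal} (hf : ∀ i, Measurable (f i)) : ∃ G, IsEssSupFamily P f G := by
  choose J hJc hJ using fun r : ℚ => exists_countable_ae_cover P
    (A := fun i => {θ | ((r : ℝ) : EReal) < f i θ}) fun i => measurableSet_lt measurable_const (hf i)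
  have hcount : (⋃ r, J r).Countable := Set.countable_iUnion hJc
  refine ⟨fun θ => ⨆ j ∈ ⋃ r, J r, f j θ, Measurable.biSup _ hcount fun i _ => hf i, fun i => ?_,
    fun H _ hle => ?_⟩
  · have hall : ∀ᵐ θ ∂P, ∀ r : ℚ, θ ∉ {θ | ((r : ℝ) : EReal) < f i θ} \
        ⋃ j ∈ J r, {θ | ((r : ℝ) : EReal) < f j θ} :=
      ae_all_iff.2 fun r => measure_eq_zero_iff_ae_notMem.1 (hJ r i)
    filter_upwards [hall] with θ hθ
    by_contra hlt
    obtain ⟨r, hr1, hr2⟩ := EReal.exists_rat_btwn_of_lt (not_le.1 hlt)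
    refine hθ r ⟨hr2, fun hmem => ?_⟩
    simp only [Set.mem_iUnion] at hmem
    obtain ⟨j, hj, hlt'⟩ := hmem
    have : f j θ ≤ ⨆ j ∈ ⋃ r, J r, f j θ :=
      le_iSup₂_of_le j (Set.mem_iUnion.2 ⟨r, hj⟩) le_rfl
    exact absurd (hlt'.trans_le this) (not_lt.2 hr1.le)
  · have hall : ∀ᵐ θ ∂P, ∀ j ∈ ⋃ r, J r, f j θ ≤ H θ :=
      (ae_ball_iff hcount).2 fun j _ => hle j
    filter_upwards [hall] with θ hθ
    exact iSup₂_le hθ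

end UtilityMax

/-! ### Measurable selection on compact sets. -/

section Selection

open Topology

variable {A E : Type*} [MeasurableSpace A] [MetricSpace E]
  [SecondCountableTopology E] [MeasurableSpace E]

/-- Measurable selection of a near-maximizer of a Carathéodory function on a compact set. -/
theorem exists_measurable_near_maximizer {K : Set E} (hK : IsCompact K) (hne : K.Nonempty)
    {G : A → E → ℝ} (hm : ∀ z, Measurable fun a => G a z) (hc : ∀ a, Continuous (G a))
    {ε : ℝ} (hε : 0 < ε) :
    ∃ p : A → E, Measurable p ∧ (∀ a, p a ∈ K) ∧ ∀ a, ∀ z ∈ K, G a z - ε ≤ G a (p a) := by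
  classical
  have : Nonempty K := hne.to_subtype
  let D := TopologicalSpace.denseSeq K
  have hD : DenseRange D := TopologicalSpace.denseRange_denseSeq K
  -- Comparing with the dense points only keeps the condition measurable; continuity extends it to
  -- all of `K`.
  have hex : ∀ a, ∃ k, ∀ j, G a (D j) - ε ≤ G a (D k) := by
    intro a
    obtain ⟨z, hz, hmax⟩ := hK.exists_isMaxOn hne (hc a).continuousOn
    have hcz : Continuous fun w : K => G a w := (hc a).comp continuous_subtype_val
    obtain ⟨k, hk⟩ := hD.exists_mem_open (s := {w : K | G a z - ε < G a w})
      (isOpen_lt continuous_const hcz) ⟨⟨z, hz⟩, by simp [hε]⟩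
    exact ⟨k, fun j => (sub_le_sub_right (hmax (D j).2) ε).trans hk.le⟩
  refine ⟨fun a => D (Nat.find (hex a)), ?_, fun a => (D _).2, fun a z hz => ?_⟩
  · refine (measurable_from_top (f := fun k => (D k : E))).comp (measurable_find hex fun k => ?_)
    have : {a | ∀ j, G a (D j) - ε ≤ G a (D k)} = ⋂ j, {a | G a (D j) - ε ≤ G a (D k)} := by
      ext a; simp
    rw [this]
    exact MeasurableSet.iInter fun j => measurableSet_le ((hm _).sub measurable_const) (hm _)
  · have hcl : IsClosed {w : K | G a w - ε ≤ G a (D (Nat.find (hex a)))} :=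
      isClosed_le (((hc a).comp continuous_subtype_val).sub continuous_const) continuous_const
    have hsub : Set.range D ⊆ {w : K | G a w - ε ≤ G a (D (Nat.find (hex a)))} := by
      rintro _ ⟨j, rfl⟩; exact Nat.find_spec (hex a) j
    exact hcl.closure_subset_iff.2 hsub (hD ⟨z, hz⟩)

variable [BorelSpace E]

theorem measurableSet_frequently_dist_lt {p : ℕ → A → E} (hp : ∀ n, Measurable (p n))
    {q : A → E} (hq : Measurable q) (ε : ℝ) :
    MeasurableSet {a | ∃ᶠ n in atTop, dist (p n a) (q a) < ε} := by
  simp only [frequently_atTop]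
  have h : {a | ∀ N, ∃ n ≥ N, dist (p n a) (q a) < ε}
      = ⋂ N, ⋃ n, ⋃ (_ : n ≥ N), {a | dist (p n a) (q a) < ε} := by
    ext a; simp
  rw [h]
  exact MeasurableSet.iInter fun N => MeasurableSet.iUnion fun n => MeasurableSet.iUnion fun _ =>
    measurableSet_lt ((hp n).dist hq) measurable_const

/-- One refinement in the construction of a cluster point: compactness gives a true cluster point
within `ε` of `q a`, and the first suitable point of a countable dense set replaces it, which is a
measurable choice. -/
theorem exists_measurable_nearer_point {K : Set E} (hK : IsCompact K) {p : ℕ → A → E}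
    (hp : ∀ n, Measurable (p n)) (hpK : ∀ n a, p n a ∈ K) {q : A → E} (hq : Measurable q)
    {ε δ : ℝ} (hδ : 0 < δ) (hF : ∀ a, ∃ᶠ n in atTop, dist (p n a) (q a) < ε) :
    ∃ q' : A → E, Measurable q' ∧ (∀ a, ∃ᶠ n in atTop, dist (p n a) (q' a) < δ) ∧
      ∀ a, dist (q a) (q' a) < ε + δ := by
  classical
  rcases isEmpty_or_nonempty E with hE | hE
  · exact ⟨q, hq, fun a => (hE.false (q a)).elim, fun a => (hE.false (q a)).elim⟩
  let D := TopologicalSpace.denseSeq E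
  have hD : DenseRange D := TopologicalSpace.denseRange_denseSeq E
  have hex : ∀ a, ∃ k, (∃ᶠ n in atTop, dist (p n a) (D k) < δ) ∧ dist (q a) (D k) < ε + δ := by
    intro a
    have hcomp : IsCompact (K ∩ Metric.closedBall (q a) ε) :=
      hK.inter_right Metric.isClosed_closedBall
    obtain ⟨z, hz, hcl⟩ := hcomp.exists_mapClusterPt_of_frequently
      (l := atTop) (f := fun n => p n a) ((hF a).mono fun n hn => ⟨hpK n a, hn.le⟩)
    obtain ⟨k, hk⟩ := hD.exists_dist_lt z hδ
    refine ⟨k, ?_, ?_⟩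
    · have := (mapClusterPt_iff_frequently.1 hcl) (Metric.ball (D k) δ)
        (Metric.isOpen_ball.mem_nhds (by simpa [dist_comm] using hk))
      simpa using this
    · have h1 : dist z (q a) ≤ ε := hz.2
      calc dist (q a) (D k) ≤ dist (q a) z + dist z (D k) := dist_triangle _ _ _
        _ < ε + δ := by rw [dist_comm (q a)]; linarith
  refine ⟨fun a => D (Nat.find (hex a)), ?_, fun a => (Nat.find_spec (hex a)).1,
    fun a => (Nat.find_spec (hex a)).2⟩
  exact (measurable_from_top (f := D)).comp (measurable_find hex fun k =>
    (measurableSet_frequently_dist_lt hp measurable_const δ).inter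
      (measurableSet_lt (hq.dist measurable_const) measurable_const))

/-- A sequence of measurable maps into a compact set has a measurable pointwise cluster point. -/
theorem exists_measurable_mapClusterPt [CompleteSpace E] {K : Set E} (hK : IsCompact K)
    {p : ℕ → A → E} (hp : ∀ n, Measurable (p n)) (hpK : ∀ n a, p n a ∈ K) :
    ∃ q : A → E, Measurable q ∧ ∀ a, MapClusterPt (q a) atTop (fun n => p n a) := by
  -- With this radius `p 0` can start the iteration; the geometric radii make the successive
  -- approximations Cauchy.
  set r : ℝ := Metric.diam K + 1 with hr
  have hr0 : 0 < r := by have := Metric.diam_nonneg (s := K); linarith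
  let good : ℕ → (A → E) → Prop := fun m q =>
    Measurable q ∧ ∀ a, ∃ᶠ n in atTop, dist (p n a) (q a) < r * (1 / 2 : ℝ) ^ m
  have step : ∀ m (q : {q // good m q}), ∃ q' : {q // good (m + 1) q},
      ∀ a, dist (q.1 a) (q'.1 a) ≤ 2 * r * (1 / 2 : ℝ) ^ m := by
    rintro m ⟨q, hq, hF⟩
    obtain ⟨q', h1, h2, h3⟩ := exists_measurable_nearer_point hK hp hpK hq
      (δ := r * (1 / 2 : ℝ) ^ (m + 1)) (by positivity) hF
    refine ⟨⟨q', h1, h2⟩, fun a => (h3 a).le.trans ?_⟩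
    have : (0 : ℝ) < r * (1 / 2) ^ m := by positivity
    rw [pow_succ]; linarith
  have base : good 0 (p 0) := by
    refine ⟨hp 0, fun a => Eventually.frequently (Eventually.of_forall fun n => ?_)⟩
    have := Metric.dist_le_diam_of_mem hK.isBounded (hpK n a) (hpK 0 a)
    simp only [pow_zero, mul_one]; linarith
  choose nxt hnxt using step
  let seq : ∀ m, {q // good m q} := fun m => Nat.rec ⟨p 0, base⟩ nxt m
  have hseq : ∀ m a, dist ((seq m).1 a) ((seq (m + 1)).1 a) ≤ 2 * r * (1 / 2 : ℝ) ^ m :=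
    fun m a => hnxt m (seq m) a
  have hlim : ∀ a, ∃ z, Tendsto (fun m => (seq m).1 a) atTop (𝓝 z) := fun a =>
    cauchySeq_tendsto_of_complete
      (cauchySeq_of_le_geometric (1 / 2) (2 * r) (by norm_num) (fun m => hseq m a))
  choose q hq using hlim
  refine ⟨q, measurable_of_tendsto_metrizable (fun m => (seq m).2.1) (tendsto_pi_nhds.2 hq),
    fun a => ?_⟩
  rw [mapClusterPt_iff_frequently]
  intro s hs
  obtain ⟨ε, hε, hεs⟩ := Metric.mem_nhds_iff.1 hs
  have h1 : ∀ᶠ m in atTop, dist ((seq m).1 a) (q a) < ε / 2 :=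
    (Metric.tendsto_nhds.1 (hq a)) _ (half_pos hε)
  have h2 : ∀ᶠ m : ℕ in atTop, r * (1 / 2 : ℝ) ^ m < ε / 2 := by
    have : Tendsto (fun m : ℕ => r * (1 / 2 : ℝ) ^ m) atTop (𝓝 (r * 0)) :=
      (tendsto_pow_atTop_nhds_zero_of_lt_one (by norm_num) (by norm_num)).const_mul r
    rw [mul_zero] at this
    exact this.eventually (gt_mem_nhds (half_pos hε))
  obtain ⟨m, hm1, hm2⟩ := (h1.and h2).exists
  refine ((seq m).2.2 a).mono fun n hn => hεs ?_
  calc dist (p n a) (q a) ≤ dist (p n a) ((seq m).1 a) + dist ((seq m).1 a) (q a) :=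
        dist_triangle _ _ _
    _ < ε := by linarith

/-- Measurable selection of a maximizer, on a compact set, of the infimum of a decreasing sequence
of Carathéodory functions. -/
theorem exists_measurable_maximizer [CompleteSpace E] {K : Set E} (hK : IsCompact K)
    (hne : K.Nonempty) {G : ℕ → A → E → ℝ} (hm : ∀ n z, Measurable fun a => G n a z)
    (hc : ∀ n a, Continuous (G n a)) (hanti : ∀ a z, Antitone fun n => G n a z) :
    ∃ p : A → E, Measurable p ∧ (∀ a, p a ∈ K) ∧
      ∀ a, ∀ z ∈ K, ∀ c, (∀ n, c ≤ G n a z) → ∀ n, c ≤ G n a (p a) := by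
  -- `p j` maximizes `G j` up to `1 / (j + 1)`. Since `G j ≤ G n` for `j ≥ n`, continuity of `G n`
  -- carries the bound to a cluster point of the `p j`.
  choose p hpm hpK hpmax using fun n : ℕ =>
    exists_measurable_near_maximizer hK hne (hm n) (hc n) (Nat.one_div_pos_of_nat (α := ℝ) (n := n))
  obtain ⟨q, hqm, hq⟩ := exists_measurable_mapClusterPt hK hpm hpK
  refine ⟨q, hqm, fun a => ?_, fun a z hz c hcz n => ?_⟩
  · exact hK.isClosed.mem_of_mapClusterPt (hq a) (Eventually.of_forall fun n => hpK n a)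
  · refine le_of_forall_pos_lt_add fun ε hε => ?_
    have hnear : {w | G n a w < G n a (q a) + ε / 2} ∈ 𝓝 (q a) :=
      (isOpen_lt (hc n a) continuous_const).mem_nhds (by simpa using half_pos hε)
    have hev : ∀ᶠ j : ℕ in atTop, n ≤ j ∧ 1 / ((j : ℝ) + 1) < ε / 2 :=
      (eventually_ge_atTop n).and
        (tendsto_one_div_add_atTop_nhds_zero_nat.eventually (gt_mem_nhds (half_pos hε)))
    obtain ⟨j, hj1, hnj, hj2⟩ := (((mapClusterPt_iff_frequently.1 (hq a)) _ hnear).and_eventually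
      hev).exists
    have h1 : G n a (p j a) < G n a (q a) + ε / 2 := hj1
    have h2 := hpmax j a z hz
    have h3 : G j a (p j a) ≤ G n a (p j a) := hanti a _ hnj
    have h4 := hcz j
    linarith

end Selection

/-! ### Good paths and the one-period problem under a fixed law. -/

namespace UtilityMax

open Topology

/-- Paths of the value functions: nondecreasing, concave, above `U`, with the growth of `U`, and
unbounded below. -/
structure GoodPath (U : ℝ → ℝ) (γ : ℝ) (f : ℝ → ℝ) : Prop where
  mono : Monotone f
  concave : ConcaveOn ℝ Set.univ f
  ge : ∀ x, U x ≤ f x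
  growth : ∀ C : ℝ, 0 < C → Growth γ C U → Growth γ C f
  unbdd : ∀ n : ℕ, ∃ m : ℕ, f (-m) < -n

/-- Left of `-m` a concave function lies below the line through its values at `-m` and `0`, whose
slope is positive once `f (-m) < f 0`. The extra `δ * m` in `b` covers the interval from `-m` to
`0`. -/
theorem GoodPath.exists_linear_bound {U f : ℝ → ℝ} {γ : ℝ} (hf : GoodPath U γ f) :
    ∃ δ > 0, ∃ b, ∀ y ≤ 0, f y ≤ b + δ * y := by
  obtain ⟨n, hn⟩ := exists_nat_ge (-f 0)
  obtain ⟨m, hm⟩ := hf.unbdd n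
  have hlt : f (-m) < f 0 := by linarith
  have hm0 : (0 : ℝ) < m := by
    rcases Nat.eq_zero_or_pos m with h | h
    · simp [h] at hlt
    · exact_mod_cast h
  have hδ : 0 < (f 0 - f (-m)) / m := div_pos (by linarith) hm0
  refine ⟨_, hδ, f 0 + (f 0 - f (-m)) / m * m, fun y hy => ?_⟩
  rcases le_total y (-m) with h | h
  · have hy0 : 0 < -y := by linarith
    have ht : m / (-y) ≤ 1 := (div_le_one hy0).2 (by linarith)
    have hc := hf.concave.2 (Set.mem_univ 0) (Set.mem_univ y) (sub_nonneg.2 ht)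
      (by positivity : (0 : ℝ) ≤ m / (-y)) (by ring)
    have harg : (1 - m / (-y)) • (0 : ℝ) + (m / (-y)) • y = -m := by
      have hy1 : -y ≠ 0 := hy0.ne'
      simp only [smul_eq_mul, mul_zero, zero_add]
      rw [div_mul_eq_mul_div, div_eq_iff hy1]; ring
    rw [harg] at hc
    simp only [smul_eq_mul] at hc
    have h1 : m / (-y) * (f y - f 0) ≤ f (-m) - f 0 := by linarith
    rw [div_mul_eq_mul_div, div_le_iff₀ hy0] at h1
    have h2 : f y - f 0 ≤ (f 0 - f (-m)) / m * y := by
      rw [div_mul_eq_mul_div, le_div_iff₀ hm0]; linarith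
    have := mul_pos hδ hm0
    linarith
  · have h1 : f y ≤ f 0 := hf.mono hy
    have := mul_nonneg hδ.le (by linarith : 0 ≤ (m : ℝ) + y)
    linarith

theorem GoodPath.continuous {U f : ℝ → ℝ} {γ : ℝ} (hf : GoodPath U γ f) : Continuous f :=
  continuousOn_univ.1 (hf.concave.continuousOn isOpen_univ)

variable {Θ : Type*} [MeasurableSpace Θ]
  {E : Type*} [NormedAddCommGroup E] [InnerProductSpace ℝ E]

/-- One-period problem under a fixed law `μ`: random function `F`, price increment `Y`. -/
structure OnePeriod [MeasurableSpace E] (U : ℝ → ℝ) (γ : ℝ) (μ : Measure Θ) (F : Θ → ℝ → ℝ)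
    (Y : Θ → E) : Prop where
  meas : Measurable (Function.uncurry F)
  measY : Measurable Y
  good : ∀ᵐ θ ∂μ, GoodPath U γ (F θ)
  integ : ∀ R : ℕ, ∫⁻ θ, ENNReal.ofReal (F θ (R + R * ‖Y θ‖)) ∂μ < ∞
  noArb : ∀ p : E, (∀ᵐ θ ∂μ, 0 ≤ inner ℝ p (Y θ)) → ∀ᵐ θ ∂μ, inner ℝ p (Y θ) = 0

/-- Terminal value with initial capital `x` and position `ξ`. -/
def payoff (F : Θ → ℝ → ℝ) (Y : Θ → E) (x : ℝ) (ξ : E) (θ : Θ) : ℝ := F θ (x + inner ℝ ξ (Y θ))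

/-- The payoff of `(x, ξ)` is integrable, with mean at least `c`. -/
def ValueGe (μ : Measure Θ) (F : Θ → ℝ → ℝ) (Y : Θ → E) (x : ℝ) (ξ : E) (c : ℝ) : Prop :=
  Integrable (payoff F Y x ξ) μ ∧ c ≤ ∫ θ, payoff F Y x ξ θ ∂μ

/-- The position `ξ` is optimal for the initial capital `x`. -/
def IsOptimal (μ : Measure Θ) (F : Θ → ℝ → ℝ) (Y : Θ → E) (x : ℝ) (ξ : E) : Prop :=
  Integrable (payoff F Y x ξ) μ ∧
    ∀ ξ', Integrable (payoff F Y x ξ') μ → ∫ θ, payoff F Y x ξ' θ ∂μ ≤ ∫ θ, payoff F Y x ξ θ ∂μ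

/-- Positions that almost surely have no effect. -/
def nullPositions (μ : Measure Θ) (Y : Θ → E) : Submodule ℝ E where
  carrier := {p | ∀ᵐ θ ∂μ, inner ℝ p (Y θ) = 0}
  add_mem' {p q} hp hq := by
    rw [Set.mem_ofPred_eq] at hp hq ⊢
    filter_upwards [hp, hq] with θ h1 h2
    rw [inner_add_left, h1, h2, add_zero]
  zero_mem' := by simp
  smul_mem' c p hp := by
    rw [Set.mem_ofPred_eq] at hp ⊢
    filter_upwards [hp] with θ h
    rw [real_inner_smul_left, h, mul_zero]

theorem add_inner_le_mul_norm {x : ℝ} {ξ y : E} {R : ℝ} (hx : x ≤ R) (hξ : ‖ξ‖ ≤ R) :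
    x + inner ℝ ξ y ≤ R + R * ‖y‖ :=
  add_le_add hx ((real_inner_le_norm ξ y).trans
    (mul_le_mul_of_nonneg_right hξ (norm_nonneg y)))

section OnePeriodLemmas

set_option linter.unusedSectionVars false

variable [MeasurableSpace E] [BorelSpace E] [FiniteDimensional ℝ E]
  {U : ℝ → ℝ} {γ : ℝ} {μ : Measure Θ} {F : Θ → ℝ → ℝ} {Y : Θ → E}

theorem OnePeriod.measurable_payoff (h : OnePeriod U γ μ F Y) (x : ℝ) (ξ : E) :
    Measurable (payoff F Y x ξ) :=
  h.meas.comp (measurable_id.prodMk (measurable_const.add (measurable_const.inner h.measY)))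

theorem OnePeriod.lintegral_payoff_lt_top (h : OnePeriod U γ μ F Y) (x : ℝ) (ξ : E) :
    ∫⁻ θ, ENNReal.ofReal (payoff F Y x ξ θ) ∂μ < ∞ := by
  obtain ⟨R, hR⟩ := exists_nat_ge (max x ‖ξ‖)
  refine lt_of_le_of_lt (lintegral_mono_ae ?_) (h.integ R)
  filter_upwards [h.good] with θ hθ
  exact ENNReal.ofReal_le_ofReal (hθ.mono
    (add_inner_le_mul_norm ((le_max_left _ _).trans hR) ((le_max_right _ _).trans hR)))

theorem OnePeriod.integrable_of_le (h : OnePeriod U γ μ F Y) {k : Θ → ℝ} (hk : Integrable k μ)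
    {x : ℝ} {ξ : E} (hle : k ≤ᵐ[μ] payoff F Y x ξ) : Integrable (payoff F Y x ξ) μ :=
  integrable_of_le_of_lintegral_ofReal hk (h.measurable_payoff x ξ) hle
    (h.lintegral_payoff_lt_top x ξ)

theorem OnePeriod.valueGe_zero [IsProbabilityMeasure μ] (h : OnePeriod U γ μ F Y) (x : ℝ) :
    ValueGe μ F Y x 0 (U x) := by
  have hle : (fun _ => U x) ≤ᵐ[μ] payoff F Y x 0 := by
    filter_upwards [h.good] with θ hθ
    simpa [payoff] using hθ.ge x
  have hI := h.integrable_of_le (integrable_const (U x)) hle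
  refine ⟨hI, ?_⟩
  have := integral_mono_ae (integrable_const (U x)) hI hle
  simpa using this

/-- Positions may be projected on the orthogonal complement of the positions without effect. -/
theorem exists_mem_orthogonal (μ : Measure Θ) (F : Θ → ℝ → ℝ) (Y : Θ → E) (ξ : E) :
    ∃ ξ' ∈ (nullPositions μ Y)ᗮ, ‖ξ'‖ ≤ ‖ξ‖ ∧ ∀ x, payoff F Y x ξ' =ᵐ[μ] payoff F Y x ξ := by
  obtain ⟨y, hy, z, hz, hyz⟩ := (nullPositions μ Y).exists_add_mem_mem_orthogonal ξ
  refine ⟨z, hz, ?_, fun x => ?_⟩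
  · have h0 : inner ℝ y z = 0 := hz y hy
    have := norm_add_sq_eq_norm_sq_add_norm_sq_of_inner_eq_zero y z h0
    rw [← hyz] at this
    nlinarith [norm_nonneg ξ, norm_nonneg z, mul_self_nonneg ‖y‖]
  · have hy' : ∀ᵐ θ ∂μ, inner ℝ y (Y θ) = 0 := hy
    filter_upwards [hy'] with θ hθ
    rw [payoff, payoff, hyz, inner_add_left, hθ, zero_add]

theorem ValueGe.congr {x : ℝ} {ξ ξ' : E} {c : ℝ} (h : ValueGe μ F Y x ξ c)
    (hξ : payoff F Y x ξ' =ᵐ[μ] payoff F Y x ξ) : ValueGe μ F Y x ξ' c :=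
  ⟨h.1.congr hξ.symm, by rw [integral_congr_ae hξ]; exact h.2⟩

/-- By absence of arbitrage, a nonzero limit direction loses with positive probability. -/
theorem OnePeriod.direction_neg (h : OnePeriod U γ μ F Y) [IsProbabilityMeasure μ] {α : ℝ} {p : E}
    (hα : α ≤ 0) (hp : p ∈ (nullPositions μ Y)ᗮ) (hne : (α, p) ≠ 0) :
    ¬ ∀ᵐ θ ∂μ, 0 ≤ α + inner ℝ p (Y θ) := by
  intro hpos
  have h1 : ∀ᵐ θ ∂μ, inner ℝ p (Y θ) = 0 := h.noArb p (by
    filter_upwards [hpos] with θ hθ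
    linarith)
  -- `p` is a position without effect and orthogonal to all such positions.
  have hp0 : p = 0 := by
    have : inner ℝ p p = 0 := hp p h1
    exact inner_self_eq_zero.1 this
  obtain ⟨θ, h2, h3⟩ := (hpos.and h1).exists
  rw [h3] at h2
  exact hne (by rw [hp0, le_antisymm hα (by linarith)]; rfl)

end OnePeriodLemmas

/-! ### Coercivity and existence of an optimal position. -/

section Coercivity

set_option linter.unusedSectionVars false

variable {Θ : Type*} [MeasurableSpace Θ]
  {E : Type*} [NormedAddCommGroup E] [InnerProductSpace ℝ E]
  [MeasurableSpace E] [BorelSpace E] [FiniteDimensional ℝ E]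
  {U : ℝ → ℝ} {γ : ℝ} {μ : Measure Θ} {F : Θ → ℝ → ℝ} {Y : Θ → E}

/-- Unbounded sequences have a normalized limit direction. -/
theorem exists_limit_direction {x : ℕ → ℝ} {ξ : ℕ → E} {x₀ : ℝ} (hx : ∀ n, x n ≤ x₀)
    {V : Submodule ℝ E} (hξ : ∀ n, ξ n ∈ V)
    (hunb : Tendsto (fun n => ‖(x n, ξ n)‖) atTop atTop) :
    ∃ (α : ℝ) (p : E) (φ : ℕ → ℕ) (L : ℕ → ℝ) (a : ℕ → ℝ) (q : ℕ → E), α ≤ 0 ∧ p ∈ V ∧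
      (α, p) ≠ 0 ∧ (∀ n, 1 ≤ L n) ∧ Tendsto L atTop atTop ∧ Tendsto a atTop (𝓝 α) ∧
      Tendsto q atTop (𝓝 p) ∧ (∀ n, a n ≤ 1) ∧ (∀ n, ‖q n‖ ≤ 1) ∧
      ∀ n, x (φ n) = L n * a n ∧ ξ (φ n) = L n • q n := by
  -- Dropping an initial segment makes every scale at least `1`, as the growth inequality requires.
  obtain ⟨N, hN⟩ := eventually_atTop.1 (hunb.eventually_ge_atTop 1)
  set w : ℕ → ℝ × E := fun n => (x (n + N), ξ (n + N)) with hw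
  have hwn : ∀ n, 1 ≤ ‖w n‖ := fun n => hN (n + N) (by omega)
  have hw0 : ∀ n, 0 < ‖w n‖ := fun n => one_pos.trans_le (hwn n)
  have hwt : Tendsto (fun n => ‖w n‖) atTop atTop := hunb.comp (tendsto_add_atTop_nat N)
  have hsphere : ∀ n, (‖w n‖⁻¹ • w n) ∈ Metric.sphere (0 : ℝ × E) 1 := by
    intro n
    rw [mem_sphere_zero_iff_norm, norm_smul, norm_inv, norm_norm, inv_mul_cancel₀ (hw0 n).ne']
  obtain ⟨⟨α, p⟩, hmem, φ, hφ, hlim⟩ := (isCompact_sphere (0 : ℝ × E) 1).tendsto_subseq hsphere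
  have hfst := (continuous_fst.tendsto _).comp hlim
  have hsnd := (continuous_snd.tendsto _).comp hlim
  have hLt : Tendsto (fun n => ‖w (φ n)‖) atTop atTop := hwt.comp hφ.tendsto_atTop
  have hnorm : ∀ n, ‖‖w n‖⁻¹ • w n‖ = 1 := fun n => mem_sphere_zero_iff_norm.1 (hsphere n)
  refine ⟨α, p, fun n => φ n + N, fun n => ‖w (φ n)‖, fun n => (‖w (φ n)‖⁻¹ • w (φ n)).1,
    fun n => (‖w (φ n)‖⁻¹ • w (φ n)).2, ?_, ?_, ?_, fun n => hwn _, hLt, hfst, hsnd, fun n => ?_,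
    fun n => ?_, fun n => ⟨?_, ?_⟩⟩
  · have h0 : Tendsto (fun n => ‖w (φ n)‖⁻¹ * |x₀|) atTop (𝓝 (0 * |x₀|)) :=
      (tendsto_inv_atTop_zero.comp hLt).mul_const _
    rw [zero_mul] at h0
    refine le_of_tendsto_of_tendsto' hfst h0 fun n => ?_
    exact mul_le_mul_of_nonneg_left ((hx _).trans (le_abs_self _)) (inv_nonneg.2 (norm_nonneg _))
  · exact V.closed_of_finiteDimensional.mem_of_tendsto hsnd
      (Eventually.of_forall fun n => V.smul_mem _ (hξ _))
  · intro h0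
    rw [h0] at hmem
    simp at hmem
  · exact (le_abs_self _).trans ((norm_fst_le _).trans (hnorm _).le)
  · exact (norm_snd_le _).trans (hnorm _).le
  · simp only [Prod.smul_fst, smul_eq_mul]
    rw [mul_inv_cancel_left₀ (hw0 _).ne']
  · simp only [Prod.smul_snd]
    rw [smul_inv_smul₀ (hw0 _).ne']

/-- Expected utility is coercive along positions orthogonal to those without effect. -/
theorem OnePeriod.coercive [IsProbabilityMeasure μ] (h : OnePeriod U γ μ F Y) (hγ : γ < 1)
    {C : ℝ} (hC : 0 < C) (hG : Growth γ C U) {x : ℕ → ℝ} {ξ : ℕ → E} {x₀ : ℝ} (hx : ∀ n, x n ≤ x₀)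
    (hξ : ∀ n, ξ n ∈ (nullPositions μ Y)ᗮ) {c : ℝ} (hval : ∀ n, ValueGe μ F Y (x n) (ξ n) c)
    (hunb : Tendsto (fun n => ‖(x n, ξ n)‖) atTop atTop) : False := by
  obtain ⟨α, p, φ, L, a, q, hα, hp, hne, hL1, hLt, ha, hq, ha1, hq1, heq⟩ :=
    exists_limit_direction hx hξ hunb
  have hL0 : ∀ n, 0 < L n := fun n => one_pos.trans_le (hL1 n)
  set Z : ℕ → Θ → ℝ := fun n θ => a n + inner ℝ (q n) (Y θ) with hZ
  have hpay : ∀ n θ, payoff F Y (x (φ n)) (ξ (φ n)) θ = F θ (L n * Z n θ) := by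
    intro n θ
    rw [payoff, (heq n).1, (heq n).2, real_inner_smul_left, hZ, mul_add]
  -- Since `a n ≤ 1` and `‖q n‖ ≤ 1`, `W` is an integrable majorant of all the `F θ (Z n θ)`.
  set W : Θ → ℝ := fun θ => max (F θ (1 + ‖Y θ‖)) 0 with hW
  have hFm : Measurable fun θ => F θ (1 + ‖Y θ‖) :=
    h.meas.comp (measurable_id.prodMk (measurable_const.add h.measY.norm))
  have hWI : Integrable W μ := by
    have := integrable_max_neg hFm (by simpa using h.integ 1) 0
    simpa using this
  have hval' : ∀ n, Integrable (fun θ => F θ (L n * Z n θ)) μ ∧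
      c ≤ ∫ θ, F θ (L n * Z n θ) ∂μ := by
    intro n
    have := hval (φ n)
    simp only [ValueGe, funext (hpay n)] at this
    exact this
  -- The slack in the second growth inequality, divided by `L n`. It is almost surely nonnegative,
  -- and its mean tends to `0` because `γ < 1` and the expected utilities are at least `c`.
  set k : ℕ → Θ → ℝ := fun n θ => L n ^ (γ - 1) * (W θ + C) - F θ (L n * Z n θ) / L n with hk
  have hkI : ∀ n, Integrable (k n) μ := fun n =>
    ((hWI.add (integrable_const C)).const_mul _).sub ((hval' n).1.div_const _)
  have hk0 : ∀ n, 0 ≤ᵐ[μ] k n := by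
    intro n
    filter_upwards [h.good] with θ hθ
    have h1 := (hθ.growth C hC hG (Z n θ) (L n) (hL1 n)).2
    have h2 : F θ (Z n θ) ≤ W θ := le_trans (hθ.mono (by
      simpa using add_inner_le_mul_norm (R := 1) (y := Y θ) (ha1 n) (hq1 n))) (le_max_left _ _)
    have h3 : 0 < L n ^ γ := Real.rpow_pos_of_pos (hL0 n) γ
    have h4 : L n ^ (γ - 1) = L n ^ γ / L n := by rw [Real.rpow_sub (hL0 n), Real.rpow_one]
    change 0 ≤ k n θ
    simp only [hk]
    rw [h4, div_mul_eq_mul_div, ← sub_div]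
    refine div_nonneg ?_ (hL0 n).le
    have := mul_le_mul_of_nonneg_left h2 h3.le
    linarith
  have hbound : ∀ n, ∫⁻ θ, ENNReal.ofReal (k n θ) ∂μ
      ≤ ENNReal.ofReal (L n ^ (γ - 1) * (∫ θ, W θ ∂μ + C) - c / L n) := by
    intro n
    rw [← ofReal_integral_eq_lintegral_ofReal (hkI n) (hk0 n)]
    refine ENNReal.ofReal_le_ofReal ?_
    simp only [hk]
    have hWC : Integrable (fun θ => W θ + C) μ := hWI.add (integrable_const C)
    rw [integral_sub (hWC.const_mul _) ((hval' n).1.div_const _),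
      integral_const_mul, integral_add hWI (integrable_const C), integral_div]
    simp only [integral_const, probReal_univ, one_smul]
    have := div_le_div_of_nonneg_right (hval' n).2 (hL0 n).le
    linarith
  have hlim0 : Tendsto (fun n => ENNReal.ofReal
      (L n ^ (γ - 1) * (∫ θ, W θ ∂μ + C) - c / L n)) atTop (𝓝 0) := by
    have h1 : Tendsto (fun n => L n ^ (γ - 1)) atTop (𝓝 0) := by
      have := (tendsto_rpow_neg_atTop (y := 1 - γ) (by linarith)).comp hLt
      simpa [Function.comp_def] using this
    have h2 : Tendsto (fun n => c / L n) atTop (𝓝 0) := hLt.const_div_atTop c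
    have h3 := (h1.mul_const (∫ θ, W θ ∂μ + C)).sub h2
    rw [zero_mul, sub_zero] at h3
    simpa using ENNReal.tendsto_ofReal h3
  have hkm : ∀ n, Measurable fun θ => ENNReal.ofReal (k n θ) := by
    intro n
    have hZm : Measurable (Z n) := measurable_const.add (measurable_const.inner h.measY)
    have : Measurable fun θ => F θ (L n * Z n θ) :=
      h.meas.comp (measurable_id.prodMk (measurable_const.mul hZm))
    exact (((((hFm.max measurable_const).add measurable_const).const_mul _).sub
      (this.div_const _))).ennreal_ofReal
  have hzero : ∀ᵐ θ ∂μ, liminf (fun n => ENNReal.ofReal (k n θ)) atTop = 0 := by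
    have hle : ∫⁻ θ, liminf (fun n => ENNReal.ofReal (k n θ)) atTop ∂μ ≤ 0 :=
      (lintegral_liminf_le hkm).trans ((liminf_le_liminf (Eventually.of_forall hbound)).trans
        hlim0.liminf_eq.le)
    exact (lintegral_eq_zero_iff (.liminf hkm)).1 (le_antisymm hle zero_le)
  refine h.direction_neg hα hp hne ?_
  filter_upwards [hzero, h.good] with θ hθ hgood
  by_contra hneg
  rw [not_le] at hneg
  set z : ℝ := α + inner ℝ p (Y θ) with hz
  have hZt : Tendsto (fun n => Z n θ) atTop (𝓝 z) :=
    ha.add (hq.inner tendsto_const_nhds)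
  obtain ⟨δ, hδ, b, hb⟩ := hgood.exists_linear_bound
  have hlow : Tendsto (fun n => -(b / L n) - δ * Z n θ) atTop (𝓝 (-0 - δ * z)) :=
    (hLt.const_div_atTop b).neg.sub (hZt.const_mul δ)
  have hpos : 0 < -0 - δ * z := by have := mul_neg_of_pos_of_neg hδ hneg; linarith
  -- Where the limit `z` is negative, `k n θ` is at least `-F θ (L n * Z n θ) / L n`, whose lower
  -- bound tends to `-δ * z > 0`. This contradicts the vanishing of the lower limit.
  have hev : ∀ᶠ n in atTop, ENNReal.ofReal ((-0 - δ * z) / 2) ≤ ENNReal.ofReal (k n θ) := by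
    filter_upwards [hlow.eventually (lt_mem_nhds (half_lt_self hpos)),
      hZt.eventually (gt_mem_nhds hneg)] with n h1 h2
    refine ENNReal.ofReal_le_ofReal (h1.le.trans ?_)
    have h3 := hb (L n * Z n θ) (mul_nonpos_of_nonneg_of_nonpos (hL0 n).le h2.le)
    have h4 : F θ (L n * Z n θ) / L n ≤ b / L n + δ * Z n θ := by
      rw [div_add' _ _ _ (hL0 n).ne']
      refine div_le_div_of_nonneg_right (h3.trans_eq (by ring)) (hL0 n).le
    have h5 : 0 ≤ L n ^ (γ - 1) * (W θ + C) :=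
      mul_nonneg (Real.rpow_pos_of_pos (hL0 n) _).le (add_nonneg (le_max_right _ _) hC.le)
    simp only [hk]
    linarith
  have := le_liminf_of_le (by isBoundedDefault) hev
  rw [hθ] at this
  exact absurd this (not_le.2 (ENNReal.ofReal_pos.2 (half_pos hpos)))

/-- Project the ball maximizers orthogonally to the positions without effect. If the projections
stay in a ball of radius `M`, they compete there and `p M` is best; if they do not, coercivity is
contradicted. -/
theorem OnePeriod.exists_ball_maximizer_ge [IsProbabilityMeasure μ] (h : OnePeriod U γ μ F Y)
    (hγ : γ < 1) {C : ℝ} (hC : 0 < C) (hG : Growth γ C U) {x : ℝ} {p : ℕ → E}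
    (hmax : ∀ (R : ℕ) (ξ : E), ‖ξ‖ ≤ R → ∀ c, ValueGe μ F Y x ξ c → ValueGe μ F Y x (p R) c) :
    ∃ M, ∀ R, ∫ θ, payoff F Y x (p R) θ ∂μ ≤ ∫ θ, payoff F Y x (p M) θ ∂μ := by
  have hU : ∀ R, ValueGe μ F Y x (p R) (U x) := fun R =>
    hmax R 0 (by simp) _ (h.valueGe_zero x)
  choose q hqV hqn hq using fun R => exists_mem_orthogonal μ F Y (p R)
  by_cases hb : ∃ M : ℕ, ∀ R, ‖q R‖ ≤ M
  · obtain ⟨M, hM⟩ := hb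
    refine ⟨M, fun R => ?_⟩
    have h1 : ValueGe μ F Y x (p R) (∫ θ, payoff F Y x (p R) θ ∂μ) := ⟨(hU R).1, le_rfl⟩
    exact (hmax M (q R) (hM R) _ (h1.congr (hq R x))).2
  · push Not at hb
    choose ψ hψ using hb
    refine (h.coercive hγ hC hG (x := fun _ => x) (ξ := fun M => q (ψ M)) (x₀ := x)
      (fun _ => le_rfl) (fun _ => hqV _) (fun M => (hU (ψ M)).congr (hq (ψ M) x)) ?_).elim
    exact tendsto_atTop_mono (fun M => (hψ M).le.trans (norm_snd_le (x, q (ψ M))))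
      tendsto_natCast_atTop_atTop

theorem OnePeriod.isOptimal_of_ball_maximizer [IsProbabilityMeasure μ] (h : OnePeriod U γ μ F Y)
    {x : ℝ} {p : ℕ → E}
    (hmax : ∀ (R : ℕ) (ξ : E), ‖ξ‖ ≤ R → ∀ c, ValueGe μ F Y x ξ c → ValueGe μ F Y x (p R) c)
    {M : ℕ} (hM : ∀ R, ∫ θ, payoff F Y x (p R) θ ∂μ ≤ ∫ θ, payoff F Y x (p M) θ ∂μ) :
    IsOptimal μ F Y x (p M) := by
  refine ⟨(hmax M 0 (by simp) _ (h.valueGe_zero x)).1, fun ξ hξ => ?_⟩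
  obtain ⟨R, hR⟩ := exists_nat_ge ‖ξ‖
  exact (hmax R ξ hR _ ⟨hξ, le_rfl⟩).2.trans (hM R)

/-- The optimal value, as a function of the initial capital, is again a good path. -/
theorem OnePeriod.goodPath_value [IsProbabilityMeasure μ] (h : OnePeriod U γ μ F Y) (hγ : γ < 1)
    {C : ℝ} (hC : 0 < C) (hG : Growth γ C U) {ξ : ℝ → E} (hopt : ∀ x, IsOptimal μ F Y x (ξ x))
    {v : ℝ → ℝ} (hv : ∀ x, v x = ∫ θ, payoff F Y x (ξ x) θ ∂μ) : GoodPath U γ v := by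
  -- Each property below reduces to exhibiting an integrable minorant of the payoff of some
  -- competing position.
  have key : ∀ (x : ℝ) (η : E) (k : Θ → ℝ), Integrable k μ → k ≤ᵐ[μ] payoff F Y x η →
      ∫ θ, k θ ∂μ ≤ v x := by
    intro x η k hk hle
    have hI := h.integrable_of_le hk hle
    rw [hv]
    exact (integral_mono_ae hk hI hle).trans ((hopt x).2 η hI)
  refine ⟨fun x y hxy => ?_, ⟨convex_univ, fun x _ y _ a b ha hb hab => ?_⟩, fun x => ?_,
    fun C' hC' hG' x l hl => ?_, ?_⟩
  · rw [hv x]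
    refine key y (ξ x) _ (hopt x).1 ?_
    filter_upwards [h.good] with θ hθ
    exact hθ.mono (by linarith)
  · have hI := ((hopt x).1.const_mul a).add ((hopt y).1.const_mul b)
    have := key (a • x + b • y) (a • ξ x + b • ξ y) _ hI (by
      filter_upwards [h.good] with θ hθ
      have hc := hθ.concave.2 (Set.mem_univ (x + inner ℝ (ξ x) (Y θ)))
        (Set.mem_univ (y + inner ℝ (ξ y) (Y θ))) ha hb hab
      simp only [smul_eq_mul] at hc
      simp only [Pi.add_apply, payoff, inner_add_left, real_inner_smul_left, smul_eq_mul]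
      refine hc.trans_eq ?_
      congr 1; ring)
    simp only [Pi.add_apply] at this
    rw [integral_add ((hopt x).1.const_mul a) ((hopt y).1.const_mul b), integral_const_mul,
      integral_const_mul, ← hv, ← hv] at this
    simpa only [smul_eq_mul] using this
  · have := (h.valueGe_zero x)
    rw [hv]
    exact this.2.trans ((hopt x).2 0 this.1)
  · have hl0 : 0 < l := by linarith
    have hlg : 0 < l ^ γ := Real.rpow_pos_of_pos hl0 γ
    -- For growth, the competitor at `x` is the optimal position at `l * x` scaled down by `l`.
    have hform : ∀ θ, payoff F Y (l * x) (ξ (l * x)) θ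
        = F θ (l * (x + inner ℝ (l⁻¹ • ξ (l * x)) (Y θ))) := by
      intro θ
      rw [payoff, real_inner_smul_left, mul_add, mul_inv_cancel_left₀ hl0.ne']
    have hstep : ∀ m : ℝ, 0 < m → (∀ᵐ θ ∂μ, payoff F Y (l * x) (ξ (l * x)) θ
        ≤ m * payoff F Y x (l⁻¹ • ξ (l * x)) θ + C' * l ^ γ) → v (l * x) ≤ m * v x + C' * l ^ γ := by
      intro m hm hle
      have hI : Integrable (fun θ => m⁻¹ * (payoff F Y (l * x) (ξ (l * x)) θ - C' * l ^ γ)) μ :=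
        ((hopt (l * x)).1.sub (integrable_const _)).const_mul _
      have := key x (l⁻¹ • ξ (l * x)) _ hI (by
        filter_upwards [hle] with θ hθ
        rw [inv_mul_le_iff₀ hm]; linarith)
      rw [integral_const_mul, integral_sub (hopt (l * x)).1 (integrable_const _), ← hv] at this
      simp only [integral_const, probReal_univ, one_smul] at this
      rw [inv_mul_le_iff₀ hm] at this
      linarith
    refine ⟨hstep l hl0 ?_, hstep (l ^ γ) hlg ?_⟩
    · filter_upwards [h.good] with θ hθ
      rw [hform]; exact (hθ.growth C' hC' hG' _ l hl).1
    · filter_upwards [h.good] with θ hθ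
      rw [hform]; exact (hθ.growth C' hC' hG' _ l hl).2
  · by_contra hcon
    push Not at hcon
    obtain ⟨n, hn⟩ := hcon
    -- If `v` were bounded below, the capitals `-m` with their projected optimal positions would
    -- violate coercivity.
    choose q hqV hqn hq using fun m : ℕ => exists_mem_orthogonal μ F Y (ξ (-(m : ℝ)))
    refine h.coercive hγ hC hG (x := fun m : ℕ => -(m : ℝ)) (ξ := q) (x₀ := 0) (c := -(n : ℝ))
      (fun m => by simp) hqV (fun m => ?_) ?_
    · have : ValueGe μ F Y (-(m : ℝ)) (ξ (-(m : ℝ))) (-(n : ℝ)) :=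
        ⟨(hopt _).1, by rw [← hv]; exact hn m⟩
      exact this.congr (hq m _)
    · refine tendsto_atTop_mono (fun m => ?_) tendsto_natCast_atTop_atTop
      simp

end Coercivity

open ProbabilityTheory

/-! ### Measurable choice of arbitrages and of optimal positions. -/

section KernelSelection

set_option linter.unusedSectionVars false

variable {Θ : Type*} [MeasurableSpace Θ]
  {E : Type*} [NormedAddCommGroup E] [InnerProductSpace ℝ E]
  [MeasurableSpace E] [BorelSpace E] [FiniteDimensional ℝ E]
  {U : ℝ → ℝ} {γ : ℝ} {F : Θ → ℝ → ℝ} {Y : Θ → E}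
  {B : Type*} {mB : MeasurableSpace B} {κ : Kernel B Θ} [IsMarkovKernel κ]

/-- If one-period arbitrage exists on a set of states, then it can be selected measurably. -/
theorem exists_measurable_arbitrage (κ : Kernel B Θ) [IsMarkovKernel κ] (hY : Measurable Y) :
    ∃ p : B → E, Measurable p ∧ ∀ ω, (∀ᵐ θ ∂κ ω, 0 ≤ inner ℝ (p ω) (Y θ)) ∧
      ((∀ᵐ θ ∂κ ω, inner ℝ (p ω) (Y θ) = 0) →
        ∀ q : E, (∀ᵐ θ ∂κ ω, 0 ≤ inner ℝ q (Y θ)) → ∀ᵐ θ ∂κ ω, inner ℝ q (Y θ) = 0) := by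
  -- A bounded continuous substitute for the positive part, with the same zero set, so that no
  -- integrability of `Y` is needed.
  let pos : ℝ → ℝ := fun s => min (max s 0) 1
  have hpos0 : ∀ s, 0 ≤ pos s := fun s => le_min (le_max_right _ _) zero_le_one
  have hpos1 : ∀ s, ‖pos s‖ ≤ 1 := fun s => by
    rw [Real.norm_of_nonneg (hpos0 s)]; exact min_le_right _ _
  have hposc : Continuous pos := (continuous_id.max continuous_const).min continuous_const
  have hposz : ∀ s, pos s = 0 ↔ s ≤ 0 := by
    intro s
    constructor
    · intro h
      by_contra hs
      have : 0 < pos s := lt_min (lt_max_of_lt_left (not_le.1 hs)) one_pos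
      exact this.ne' h
    · intro h
      simp only [pos, max_eq_right h]
      simp
  have hin : ∀ z : E, Measurable fun θ => (inner ℝ z (Y θ) : ℝ) := fun z =>
    measurable_const.inner hY
  have hintp : ∀ ω z, Integrable (fun θ => pos (inner ℝ z (Y θ))) (κ ω) := fun ω z =>
    Integrable.of_bound (hposc.measurable.comp (hin z)).aestronglyMeasurable 1
      (Eventually.of_forall fun θ => hpos1 _)
  have hintn : ∀ ω z, Integrable (fun θ => pos (-inner ℝ z (Y θ))) (κ ω) := fun ω z =>
    Integrable.of_bound (hposc.measurable.comp (hin z).neg).aestronglyMeasurable 1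
      (Eventually.of_forall fun θ => hpos1 _)
  let a : B → E → ℝ := fun ω z => ∫ θ, pos (-inner ℝ z (Y θ)) ∂κ ω
  let b : B → E → ℝ := fun ω z => ∫ θ, pos (inner ℝ z (Y θ)) ∂κ ω
  have ha0 : ∀ ω z, 0 ≤ a ω z := fun ω z => integral_nonneg fun θ => hpos0 _
  have ham : ∀ z, Measurable fun ω => a ω z := fun z =>
    ((hposc.measurable.comp (hin z).neg).stronglyMeasurable.integral_kernel).measurable
  have hbm : ∀ z, Measurable fun ω => b ω z := fun z =>
    ((hposc.measurable.comp (hin z)).stronglyMeasurable.integral_kernel).measurable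
  have hac : ∀ ω, Continuous (a ω) := fun ω =>
    continuous_of_dominated (bound := fun _ => 1) (fun z => (hintn ω z).1)
      (fun z => Eventually.of_forall fun θ => hpos1 _) (integrable_const _)
      (Eventually.of_forall fun θ => hposc.comp (continuous_id.inner continuous_const).neg)
  have hbc : ∀ ω, Continuous (b ω) := fun ω =>
    continuous_of_dominated (bound := fun _ => 1) (fun z => (hintp ω z).1)
      (fun z => Eventually.of_forall fun θ => hpos1 _) (integrable_const _)
      (Eventually.of_forall fun θ => hposc.comp (continuous_id.inner continuous_const))
  have hazero : ∀ ω z, a ω z = 0 ↔ ∀ᵐ θ ∂κ ω, 0 ≤ inner ℝ z (Y θ) := by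
    intro ω z
    rw [integral_eq_zero_iff_of_nonneg (fun θ => hpos0 _) (hintn ω z)]
    refine eventually_congr (Eventually.of_forall fun θ => ?_)
    rw [Pi.zero_apply, hposz, neg_nonpos]
  have hbzero : ∀ ω z, b ω z = 0 ↔ ∀ᵐ θ ∂κ ω, inner ℝ z (Y θ) ≤ 0 := by
    intro ω z
    rw [integral_eq_zero_iff_of_nonneg (fun θ => hpos0 _) (hintp ω z)]
    refine eventually_congr (Eventually.of_forall fun θ => ?_)
    rw [Pi.zero_apply, hposz]
  -- `b` measures gains and `a` losses. Penalizing losses with weight `n → ∞` yields a maximizer of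
  -- gains among the lossless positions of the unit ball; the competitor `0` forces the maximizer
  -- itself to be lossless.
  obtain ⟨p, hpm, -, hp⟩ := exists_measurable_maximizer (isCompact_closedBall (0 : E) 1)
    ⟨0, by simp⟩ (G := fun n ω z => b ω z - n * a ω z)
    (fun n z => (hbm z).sub ((ham z).const_mul _))
    (fun n ω => (hbc ω).sub ((hac ω).const_smul (n : ℝ)))
    (fun ω z m n hmn => sub_le_sub_left
      (mul_le_mul_of_nonneg_right (by exact_mod_cast hmn) (ha0 ω z)) _)
  refine ⟨p, hpm, fun ω => ?_⟩
  have hap : a ω (p ω) = 0 := by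
    have h0 := hp ω 0 (by simp) 0 (fun n => by simp [a, b, pos])
    by_contra hne
    have hpos' : 0 < a ω (p ω) := lt_of_le_of_ne (ha0 _ _) (Ne.symm hne)
    obtain ⟨n, hn⟩ := exists_nat_gt (b ω (p ω) / a ω (p ω))
    rw [div_lt_iff₀ hpos'] at hn
    have := h0 n
    linarith
  refine ⟨(hazero ω _).1 hap, fun hzero q hq => ?_⟩
  have hs : 0 < (1 + ‖q‖)⁻¹ := by positivity
  set q' : E := (1 + ‖q‖)⁻¹ • q with hq'
  have hq'K : q' ∈ Metric.closedBall (0 : E) 1 := by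
    rw [mem_closedBall_zero_iff, hq', norm_smul, Real.norm_of_nonneg hs.le,
      inv_mul_le_iff₀ (by positivity)]
    linarith
  have haq : a ω q' = 0 := by
    rw [hazero]
    filter_upwards [hq] with θ hθ
    rw [hq', real_inner_smul_left]; exact mul_nonneg hs.le hθ
  have hbp : b ω (p ω) = 0 := by
    rw [hbzero]; filter_upwards [hzero] with θ hθ using hθ.le
  have h1 := hp ω q' hq'K (b ω q') (fun n => by simp [haq]) 0
  have h2 : b ω q' = 0 := by
    refine le_antisymm ?_ (integral_nonneg fun θ => hpos0 _)
    simpa [hbp] using h1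
  filter_upwards [hq, (hbzero ω q').1 h2] with θ h3 h4
  rw [hq', real_inner_smul_left] at h4
  exact le_antisymm (nonpos_of_mul_nonpos_right h4 hs) h3

/-- The truncation supplies the lower bound for dominated convergence; without it the expected
utility need not be continuous in the position. -/
theorem OnePeriod.continuous_integral_max {μ : Measure Θ} [IsProbabilityMeasure μ]
    (h : OnePeriod U γ μ F Y) (x : ℝ) (n : ℕ) :
    Continuous fun ξ : E => ∫ θ, max (payoff F Y x ξ θ) (-n) ∂μ := by
  refine continuous_iff_continuousAt.2 fun ξ₀ => ?_
  obtain ⟨R, hR⟩ := exists_nat_ge (max x (‖ξ₀‖ + 1))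
  have hFm : Measurable fun θ => F θ (R + R * ‖Y θ‖) :=
    h.meas.comp (measurable_id.prodMk (measurable_const.add (h.measY.norm.const_mul _)))
  have hI : Integrable (fun θ => max (F θ (R + R * ‖Y θ‖)) 0) μ := by
    simpa using integrable_max_neg hFm (h.integ R) 0
  refine continuousAt_of_dominated (bound := fun θ => max (F θ (R + R * ‖Y θ‖)) 0 + n)
    (Eventually.of_forall fun ξ =>
      ((h.measurable_payoff x ξ).max measurable_const).aestronglyMeasurable) ?_
    (hI.add (integrable_const _)) ?_
  · filter_upwards [Metric.ball_mem_nhds ξ₀ one_pos] with ξ hξ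
    have hξR : ‖ξ‖ ≤ R := by
      have h1 : ‖ξ - ξ₀‖ < 1 := mem_ball_iff_norm.1 hξ
      have h2 := norm_add_le (ξ - ξ₀) ξ₀
      rw [sub_add_cancel] at h2
      have h3 := (le_max_right _ _).trans hR
      linarith
    filter_upwards [h.good] with θ hθ
    have h1 : payoff F Y x ξ θ ≤ F θ (R + R * ‖Y θ‖) :=
      hθ.mono (add_inner_le_mul_norm ((le_max_left _ _).trans hR) hξR)
    have h2 := le_max_right (F θ (R + R * ‖Y θ‖)) 0
    have h3 := le_max_left (F θ (R + R * ‖Y θ‖)) 0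
    have hn : (0 : ℝ) ≤ n := Nat.cast_nonneg n
    rw [Real.norm_eq_abs, abs_le]
    exact ⟨le_trans (by linarith) (le_max_right _ _), max_le (by linarith) (by linarith)⟩
  · filter_upwards [h.good] with θ hθ
    exact ((hθ.continuous.comp (continuous_const.add
      (continuous_id.inner continuous_const))).max continuous_const).continuousAt

theorem measurable_integral_comp {f : (ℝ × B) × Θ → ℝ} (hf : Measurable f) :
    Measurable fun a : ℝ × B => ∫ θ, f (a, θ) ∂κ a.2 := by
  have := (hf.stronglyMeasurable.integral_kernel_prod_right'
    (κ := κ.comap Prod.snd measurable_snd)).measurable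
  simpa only [Kernel.comap_apply] using this

/-- Measurable selection of optimal positions, jointly in the initial capital and the state. -/
theorem exists_measurable_optimal {B₀ : Set B} (hB₀ : MeasurableSet B₀)
    (h : ∀ ω ∈ B₀, OnePeriod U γ (κ ω) F Y) (hF : Measurable (Function.uncurry F))
    (hY : Measurable Y) (hγ : γ < 1) {C : ℝ} (hC : 0 < C) (hG : Growth γ C U)
    (hU : GoodPath U γ U) :
    ∃ (ξ : ℝ → B → E) (v : ℝ → B → ℝ), Measurable (fun a : ℝ × B => ξ a.1 a.2) ∧
      (∀ x, Measurable (v x)) ∧ (∀ ω, GoodPath U γ fun x => v x ω) ∧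
      ∀ ω ∈ B₀, ∀ x, IsOptimal (κ ω) F Y x (ξ x ω) ∧
        v x ω = ∫ θ, payoff F Y x (ξ x ω) θ ∂κ ω := by
  classical
  have hpm : ∀ q : ℝ × B → E, Measurable q →
      Measurable fun a : (ℝ × B) × Θ => payoff F Y a.1.1 (q a.1) a.2 := fun q hq =>
    hF.comp (measurable_snd.prodMk ((measurable_fst.comp measurable_fst).add
      ((hq.comp measurable_fst).inner (hY.comp measurable_snd))))
  have hB₀' : MeasurableSet {a : ℝ × B | a.2 ∈ B₀} := measurable_snd hB₀
  -- The truncated values decrease in `n`, which is the form `exists_measurable_maximizer` requires.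
  let G : ℕ → ℝ × B → E → ℝ := fun n a z =>
    if a.2 ∈ B₀ then ∫ θ, max (payoff F Y a.1 z θ) (-n) ∂κ a.2 else 0
  have hGm : ∀ n z, Measurable fun a => G n a z := fun n z =>
    Measurable.ite hB₀' (measurable_integral_comp
      ((hpm (fun _ => z) measurable_const).max measurable_const)) measurable_const
  have hGc : ∀ n a, Continuous (G n a) := by
    intro n a
    by_cases ha : a.2 ∈ B₀
    · simp only [G, ha, if_true]
      exact (h _ ha).continuous_integral_max a.1 n
    · simp only [G, ha, if_false]
      exact continuous_const
  have hGa : ∀ a z, Antitone fun n => G n a z := by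
    intro a z m n hmn
    by_cases ha : a.2 ∈ B₀
    · simp only [G, ha, if_true]
      have hm := (h _ ha).measurable_payoff a.1 z
      have hl := (h _ ha).lintegral_payoff_lt_top a.1 z
      have hmn' : (m : ℝ) ≤ n := by exact_mod_cast hmn
      exact integral_mono (integrable_max_neg hm hl n) (integrable_max_neg hm hl m)
        fun θ => max_le_max le_rfl (neg_le_neg hmn')
    · simp only [G, ha, if_false, le_refl]
  choose p hpmeas hpK hpmax using fun R : ℕ => exists_measurable_maximizer
    (isCompact_closedBall (0 : E) R) ⟨0, by simp⟩ hGm hGc hGa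
  have hball : ∀ x, ∀ ω ∈ B₀, ∀ (R : ℕ) (z : E), ‖z‖ ≤ R → ∀ c,
      ValueGe (κ ω) F Y x z c → ValueGe (κ ω) F Y x (p R (x, ω)) c := by
    intro x ω hω R z hz c hc
    refine integrable_of_forall_le_integral_max ((h ω hω).measurable_payoff x _)
      ((h ω hω).lintegral_payoff_lt_top x _) fun n => ?_
    have := hpmax R (x, ω) z (by simpa using hz) c (fun n => by
      simp only [G, hω, if_true]
      exact hc.2.trans (integral_mono hc.1 (integrable_max_neg ((h ω hω).measurable_payoff x _)
        ((h ω hω).lintegral_payoff_lt_top x _) n) fun θ => le_max_left _ _)) n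
    simpa only [G, hω, if_true] using this
  let J : ℕ → ℝ × B → ℝ := fun R a => ∫ θ, payoff F Y a.1 (p R a) θ ∂κ a.2
  have hJm : ∀ R, Measurable (J R) := fun R => measurable_integral_comp (hpm (p R) (hpmeas R))
  -- The alternative `a.2 ∉ B₀` makes the search for the least sufficient radius total.
  have hex : ∀ a : ℝ × B, ∃ M, a.2 ∉ B₀ ∨ ∀ R, J R a ≤ J M a := by
    intro a
    by_cases ha : a.2 ∈ B₀
    · obtain ⟨M, hM⟩ := (h _ ha).exists_ball_maximizer_ge hγ hC hG (hball a.1 a.2 ha)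
      exact ⟨M, Or.inr hM⟩
    · exact ⟨0, Or.inl ha⟩
  have hexm : ∀ M, MeasurableSet {a : ℝ × B | a.2 ∉ B₀ ∨ ∀ R, J R a ≤ J M a} := by
    intro M
    have : {a : ℝ × B | a.2 ∉ B₀ ∨ ∀ R, J R a ≤ J M a}
        = {a | a.2 ∈ B₀}ᶜ ∪ ⋂ R, {a | J R a ≤ J M a} := by ext a; simp
    rw [this]
    exact hB₀'.compl.union (MeasurableSet.iInter fun R => measurableSet_le (hJm R) (hJm M))
  let q : ℝ × B → E := fun a => p (Nat.find (hex a)) a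
  have hqm : Measurable q := Measurable.find hpmeas hexm hex
  -- The default `U x` off `B₀` keeps every path good, without exceptional states.
  let v : ℝ → B → ℝ := fun x ω => if ω ∈ B₀ then ∫ θ, payoff F Y x (q (x, ω)) θ ∂κ ω else U x
  have hopt : ∀ ω ∈ B₀, ∀ x, IsOptimal (κ ω) F Y x (q (x, ω)) := by
    intro ω hω x
    refine (h ω hω).isOptimal_of_ball_maximizer (p := fun R => p R (x, ω)) (hball x ω hω) ?_
    exact (Nat.find_spec (hex (x, ω))).resolve_left (not_not.2 hω)
  refine ⟨fun x ω => q (x, ω), v, hqm, fun x => ?_, fun ω => ?_, fun ω hω x =>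
    ⟨hopt ω hω x, if_pos hω⟩⟩
  · exact Measurable.ite hB₀ ((measurable_integral_comp (hpm q hqm)).comp
      (measurable_const.prodMk measurable_id)) measurable_const
  · by_cases hω : ω ∈ B₀
    · exact (h ω hω).goodPath_value hγ hC hG (hopt ω hω) fun x => if_pos hω
    · simpa only [v, hω, if_false] using hU

end KernelSelection

/-! ### Regular conditional laws. -/

section ConditionalKernel

set_option linter.unusedSectionVars false

variable {Ω β Θ : Type*} {m : MeasurableSpace Ω} {mΩ : MeasurableSpace Ω}
  {mβ : MeasurableSpace β} [MeasurableSpace Θ]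
  [StandardBorelSpace Θ] [Nonempty Θ]

theorem setLIntegral_condDistrib {P : Measure Ω} [IsProbabilityMeasure P] {X : Ω → β}
    (hX : Measurable X) {Z : Ω → Θ} (hZ : Measurable Z) {Φ : β × Θ → ℝ≥0∞} (hΦ : Measurable Φ)
    {s : Set β} (hs : MeasurableSet s) :
    ∫⁻ ω in X ⁻¹' s, ∫⁻ θ, Φ (X ω, θ) ∂condDistrib Z X P (X ω) ∂P
      = ∫⁻ ω in X ⁻¹' s, Φ (X ω, Z ω) ∂P := by
  have h1 := Measure.setLIntegral_compProd (μ := P.map X) (κ := condDistrib Z X P) hΦ hs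
    MeasurableSet.univ
  rw [compProd_map_condDistrib hZ.aemeasurable,
    setLIntegral_map (hs.prod MeasurableSet.univ) hΦ (hX.prodMk hZ)] at h1
  simp only [Measure.restrict_univ] at h1
  rw [setLIntegral_map hs hΦ.lintegral_kernel_prod_right' hX] at h1
  rw [← h1]
  congr 2
  ext ω; simp

/-- Regular conditional law of `Z` given the σ-algebra `m`. -/
theorem exists_condLExp_kernel (hm : m ≤ mΩ) (P : Measure Ω)
    [IsProbabilityMeasure P] {Z : Ω → Θ} (hZ : Measurable Z) :
    ∃ κ : @Kernel Ω Θ m _, @IsMarkovKernel Ω Θ m _ κ ∧ ∀ Φ : Ω × Θ → ℝ≥0∞,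
      Measurable[m.prod inferInstance] Φ →
      (fun ω => ∫⁻ θ, Φ (ω, θ) ∂κ ω) =ᵐ[P] condLExp m P (fun ω => Φ (ω, Z ω)) := by
  -- Conditioning on `m` is conditioning on the identity, viewed as a map from `Ω` with `mΩ` to `Ω`
  -- with `m`.
  refine ⟨@condDistrib Ω Ω Θ _ _ _ mΩ m Z id P _, inferInstance, fun Φ hΦ => ?_⟩
  refine ae_eq_condLExp hm P _ ?_ fun s hs => ?_
  · exact hΦ.lintegral_kernel_prod_right'
  · exact setLIntegral_condDistrib (mβ := m) (X := id) hm hZ hΦ hs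

theorem measurable_indicator_one {α : Type*} {mα : MeasurableSpace α} {A : Set α}
    (hA : MeasurableSet A) : Measurable (A.indicator (1 : α → ℝ≥0∞)) :=
  measurable_one.indicator hA

/-- Integrating the indicator of the complement both ways identifies the null sets. Almost sure
properties thus pass to the conditional laws (good paths), and selections made under those laws pass
back (absence of arbitrage). -/
theorem ae_kernel_iff (hm : m ≤ mΩ) {P : Measure Ω}
    [IsProbabilityMeasure P] {Z : Ω → Θ} {κ : @Kernel Ω Θ m _} [hM : @IsMarkovKernel Ω Θ m _ κ]
    (hκ : ∀ Φ : Ω × Θ → ℝ≥0∞, Measurable[m.prod inferInstance] Φ →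
      (fun ω => ∫⁻ θ, Φ (ω, θ) ∂κ ω) =ᵐ[P] condLExp m P (fun ω => Φ (ω, Z ω)))
    (hZ : Measurable Z)
    {A : Set (Ω × Θ)} (hA : MeasurableSet[m.prod inferInstance] A) :
    (∀ᵐ ω ∂P, (ω, Z ω) ∈ A) ↔ ∀ᵐ ω ∂P, ∀ᵐ θ ∂κ ω, (ω, θ) ∈ A := by
  have hle : m.prod inferInstance ≤ (inferInstance : MeasurableSpace (Ω × Θ)) :=
    sup_le_sup (MeasurableSpace.comap_mono hm) le_rfl
  have hA' : MeasurableSet A := hle _ hA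
  let Φ : Ω × Θ → ℝ≥0∞ := Aᶜ.indicator 1
  have hΦ : Measurable[m.prod inferInstance] Φ := measurable_indicator_one hA.compl
  have hΦ' : Measurable Φ := measurable_indicator_one hA'.compl
  have hκΦ := hκ Φ hΦ
  have h0 : ∀ a, Φ a = 0 ↔ a ∈ A := fun a => by
    simp [Φ]
  have h1 : ∫⁻ ω, Φ (ω, Z ω) ∂P = ∫⁻ ω, ∫⁻ θ, Φ (ω, θ) ∂κ ω ∂P := by
    rw [lintegral_congr_ae hκΦ, lintegral_condLExp hm]
  have h2 : (∀ᵐ ω ∂P, (ω, Z ω) ∈ A) ↔ ∫⁻ ω, Φ (ω, Z ω) ∂P = 0 := by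
    have hcomp : Measurable fun ω => Φ (ω, Z ω) := hΦ'.comp (measurable_id.prodMk hZ)
    rw [lintegral_eq_zero_iff hcomp]
    exact eventually_congr (Eventually.of_forall fun ω => (h0 _).symm)
  have hkm : Measurable fun ω => ∫⁻ θ, Φ (ω, θ) ∂κ ω :=
    (hΦ.lintegral_kernel_prod_right').mono hm le_rfl
  rw [h2, h1, lintegral_eq_zero_iff hkm]
  refine eventually_congr (Eventually.of_forall fun ω => ?_)
  have hsec : Measurable fun θ => Φ (ω, θ) := hΦ'.comp measurable_prodMk_left
  rw [Pi.zero_apply, lintegral_eq_zero_iff hsec]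
  exact eventually_congr (Eventually.of_forall fun θ => h0 _)

end ConditionalKernel

/-! ### The space of continuous paths. -/

section PathSpace

instance pathMeasurableSpace : MeasurableSpace C(ℝ, ℝ) := borel _

instance pathBorelSpace : BorelSpace C(ℝ, ℝ) := ⟨rfl⟩

theorem measurable_path_eval : Measurable (fun a : C(ℝ, ℝ) × ℝ => a.1 a.2) :=
  (continuous_eval).measurable

/-- Evaluation at the rationals is a continuous injection from a Polish space, hence a measurable
embedding. -/
theorem measurable_path_iff {Ω : Type*} [MeasurableSpace Ω] {Z : Ω → C(ℝ, ℝ)} :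
    Measurable Z ↔ ∀ x, Measurable fun ω => Z ω x := by
  refine ⟨fun h x => measurable_path_eval.comp (h.prodMk measurable_const), fun h => ?_⟩
  let e : C(ℝ, ℝ) → (ℚ → ℝ) := fun f q => f q
  have he : Continuous e := continuous_pi fun q => continuous_eval_const (q : ℝ)
  have hinj : Function.Injective e := fun f g hfg =>
    DFunLike.coe_injective (Rat.denseRange_cast.equalizer f.continuous g.continuous (by
      ext q; exact congrFun hfg q))
  exact (he.measurableEmbedding hinj).measurable_comp_iff.1
    (measurable_pi_iff.2 fun q => h q)

/-- All conditions but the last are intersections, possibly uncountable, of closed sets;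
unboundedness below is a countable combination of open sets. -/
theorem measurableSet_goodPath (U : ℝ → ℝ) (γ : ℝ) :
    MeasurableSet {f : C(ℝ, ℝ) | GoodPath U γ f} := by
  have ev : ∀ x : ℝ, Continuous fun f : C(ℝ, ℝ) => f x := fun x => continuous_eval_const x
  have h1 : IsClosed {f : C(ℝ, ℝ) | ∀ x y, x ≤ y → f x ≤ f y} := by
    simp only [Set.ofPred_forall]
    exact isClosed_iInter fun x => isClosed_iInter fun y => isClosed_iInter fun _ =>
      isClosed_le (ev x) (ev y)
  have h2 : IsClosed {f : C(ℝ, ℝ) | ∀ x y a b : ℝ, 0 ≤ a → 0 ≤ b → a + b = 1 →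
      a * f x + b * f y ≤ f (a * x + b * y)} := by
    simp only [Set.ofPred_forall]
    exact isClosed_iInter fun x => isClosed_iInter fun y => isClosed_iInter fun a =>
      isClosed_iInter fun b => isClosed_iInter fun _ => isClosed_iInter fun _ =>
      isClosed_iInter fun _ => isClosed_le (((ev x).const_mul a).add ((ev y).const_mul b)) (ev _)
  have h3 : IsClosed {f : C(ℝ, ℝ) | ∀ x, U x ≤ f x} := by
    simp only [Set.ofPred_forall]
    exact isClosed_iInter fun x => isClosed_le continuous_const (ev x)
  have h4 : IsClosed {f : C(ℝ, ℝ) | ∀ C : ℝ, 0 < C → Growth γ C U → Growth γ C f} := by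
    simp only [Growth, Set.ofPred_forall, Set.ofPred_and]
    exact isClosed_iInter fun C => isClosed_iInter fun _ => isClosed_iInter fun _ =>
      isClosed_iInter fun x => isClosed_iInter fun l => isClosed_iInter fun _ =>
      (isClosed_le (ev _) (((ev x).const_mul l).add continuous_const)).inter
      (isClosed_le (ev _) (((ev x).const_mul _).add continuous_const))
  have h5 : MeasurableSet {f : C(ℝ, ℝ) | ∀ n : ℕ, ∃ m : ℕ, f (-m) < -n} := by
    simp only [Set.ofPred_forall, Set.ofPred_exists]
    exact MeasurableSet.iInter fun n => MeasurableSet.iUnion fun m =>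
      (isOpen_lt (ev _) continuous_const).measurableSet
  convert (h1.measurableSet.inter h2.measurableSet).inter
    ((h3.measurableSet.inter h4.measurableSet).inter h5) using 1
  ext f
  refine ⟨fun h => ⟨⟨fun x y => @h.mono x y, fun x y a b ha hb hab =>
    h.concave.2 trivial trivial ha hb hab⟩, ⟨h.ge, h.growth⟩, h.unbdd⟩, ?_⟩
  rintro ⟨⟨h1, h2⟩, ⟨h3, h4⟩, h5⟩
  exact ⟨fun x y => h1 x y, ⟨convex_univ, fun x _ y _ a b ha hb hab => h2 x y a b ha hb hab⟩,
    h3, h4, h5⟩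

end PathSpace

/-! ### Sign vectors. -/

section Signs

/-- The vector of signs given by a Boolean vector. -/
def signVector {d : ℕ} (ε : Fin d → Bool) : EuclideanSpace ℝ (Fin d) :=
  WithLp.toLp 2 fun i => if ε i then 1 else -1

/-- The signs of the coordinates turn the inner product into the `ℓ¹` norm. Thus finitely many
positions control `‖y‖`. -/
theorem exists_norm_le_inner_signVector {d : ℕ} (y : EuclideanSpace ℝ (Fin d)) :
    ∃ ε, ‖y‖ ≤ inner ℝ (signVector ε) y := by
  refine ⟨fun i => decide (0 ≤ y i), ?_⟩
  have h1 : inner ℝ (signVector fun i => decide (0 ≤ y i)) y = ∑ i, |y i| := by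
    rw [PiLp.inner_apply]
    refine Finset.sum_congr rfl fun i _ => ?_
    by_cases h : 0 ≤ y i
    · simp [signVector, h, abs_of_nonneg h]
    · simp [signVector, h, abs_of_neg (not_le.1 h)]
  rw [h1, EuclideanSpace.norm_eq]
  refine Real.sqrt_le_iff.2 ⟨Finset.sum_nonneg fun i _ => abs_nonneg _, ?_⟩
  simpa using Finset.sum_sq_le_sq_sum_of_nonneg (s := Finset.univ) (f := fun i => |y i|)
    fun i _ => abs_nonneg _

end Signs

/-! ### One backward step. -/

section OneStep

variable {Ω : Type*} {m : MeasurableSpace Ω} {mΩ : MeasurableSpace Ω} {d : ℕ}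

/-- The coordinate process of paths and increments. -/
def pathEval (θ : C(ℝ, ℝ) × EuclideanSpace ℝ (Fin d)) (x : ℝ) : ℝ := θ.1 x

theorem measurable_pathEval :
    Measurable (Function.uncurry (pathEval (d := d))) :=
  measurable_path_eval.comp ((measurable_fst.comp measurable_fst).prodMk measurable_snd)

theorem measurable_payoff_pathEval {B : Type*} {mB : MeasurableSpace B}
    {η : B → EuclideanSpace ℝ (Fin d)} (hη : Measurable η) (x : ℝ) :
    Measurable fun a : B × (C(ℝ, ℝ) × EuclideanSpace ℝ (Fin d)) =>
      payoff pathEval Prod.snd x (η a.1) a.2 :=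
  measurable_pathEval.comp (measurable_snd.prodMk (measurable_const.add
    ((hη.comp measurable_fst).inner (measurable_snd.comp measurable_snd))))

theorem measurable_inner_snd_snd {B : Type*} {mB : MeasurableSpace B}
    {η : B → EuclideanSpace ℝ (Fin d)} (hη : Measurable η) :
    Measurable fun a : B × (C(ℝ, ℝ) × EuclideanSpace ℝ (Fin d)) =>
      (inner ℝ (η a.1) a.2.2 : ℝ) :=
  (hη.comp measurable_fst).inner (measurable_snd.comp measurable_snd)

/-- Pathwise integrability follows from integrability at finitely many sign vectors. -/
theorem lintegral_norm_lt_top_of_signVector {U : ℝ → ℝ} {γ : ℝ}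
    {μ : Measure (C(ℝ, ℝ) × EuclideanSpace ℝ (Fin d))}
    (hgood : ∀ᵐ θ ∂μ, GoodPath U γ (pathEval θ)) {R : ℕ}
    (h : ∀ ε : Fin d → Bool, ∫⁻ θ, ENNReal.ofReal
      (payoff pathEval Prod.snd R ((R : ℝ) • signVector ε) θ) ∂μ < ∞) :
    ∫⁻ θ, ENNReal.ofReal (pathEval θ (R + R * ‖θ.2‖)) ∂μ < ∞ := by
  refine lt_of_le_of_lt (b := ∑ ε : Fin d → Bool, ∫⁻ θ, ENNReal.ofReal
    (payoff pathEval Prod.snd R ((R : ℝ) • signVector ε) θ) ∂μ) ?_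
    (ENNReal.sum_lt_top.2 fun ε _ => h ε)
  have hm : ∀ ε : Fin d → Bool, Measurable fun θ : C(ℝ, ℝ) × EuclideanSpace ℝ (Fin d) =>
      ENNReal.ofReal (payoff pathEval Prod.snd R ((R : ℝ) • signVector ε) θ) := fun ε =>
    (measurable_pathEval.comp (measurable_id.prodMk (measurable_const.add
      (measurable_const.inner measurable_snd)))).ennreal_ofReal
  rw [← lintegral_finsetSum _ fun ε _ => hm ε]
  refine lintegral_mono_ae ?_
  filter_upwards [hgood] with θ hθ
  obtain ⟨ε, hε⟩ := exists_norm_le_inner_signVector θ.2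
  refine le_trans (ENNReal.ofReal_le_ofReal (hθ.mono ?_)) (Finset.single_le_sum
    (f := fun ε => ENNReal.ofReal (payoff pathEval Prod.snd R ((R : ℝ) • signVector ε) θ))
    (fun _ _ => zero_le) (Finset.mem_univ ε))
  rw [real_inner_smul_left]
  have : (R : ℝ) * ‖θ.2‖ ≤ R * inner ℝ (signVector ε) θ.2 :=
    mul_le_mul_of_nonneg_left hε (Nat.cast_nonneg R)
  linarith

/-- One backward step of the dynamic programming recursion. -/
theorem exists_one_step (hm : m ≤ mΩ) (P : Measure Ω) [IsProbabilityMeasure P]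
    (hnull : ∀ N : Set Ω, MeasurableSet N → P N = 0 → MeasurableSet[m] N)
    {U : ℝ → ℝ} {γ : ℝ} (hγ : γ < 1) {C : ℝ} (hC : 0 < C) (hG : Growth γ C U)
    (hU : GoodPath U γ U) {V : ℝ → Ω → ℝ} (hVm : ∀ x, Measurable (V x))
    (hVg : ∀ ω, GoodPath U γ fun x => V x ω)
    {D : Ω → EuclideanSpace ℝ (Fin d)} (hD : Measurable D)
    (hNA : ∀ η : Ω → EuclideanSpace ℝ (Fin d), Measurable[m] η →
      (∀ᵐ ω ∂P, 0 ≤ inner ℝ (η ω) (D ω)) → ∀ᵐ ω ∂P, inner ℝ (η ω) (D ω) = 0)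
    (hfin : ∀ x, ∀ η : Ω → EuclideanSpace ℝ (Fin d), Measurable[m] η →
      ∀ᵐ ω ∂P, condLExp m P (fun ω => ENNReal.ofReal (V (x + inner ℝ (η ω) (D ω)) ω)) ω < ∞) :
    ∃ (ξ : ℝ → Ω → EuclideanSpace ℝ (Fin d)) (v : ℝ → Ω → ℝ),
      Measurable[(borel ℝ).prod m] (fun a : ℝ × Ω => ξ a.1 a.2) ∧
      (∀ x, Measurable[m] (v x)) ∧ (∀ ω, GoodPath U γ fun x => v x ω) ∧
      ∀ x, (fun ω => (v x ω : EReal)) =ᵐ[P]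
          genCondExp m P (fun ω => V (x + inner ℝ (ξ x ω) (D ω)) ω) ∧
        ∀ η : Ω → EuclideanSpace ℝ (Fin d), Measurable[m] η →
          genCondExp m P (fun ω => V (x + inner ℝ (η ω) (D ω)) ω)
            ≤ᵐ[P] fun ω => (v x ω : EReal) := by
  -- Carrying the whole path in `Z` lets one kernel handle every capital and position.
  let Z : Ω → C(ℝ, ℝ) × EuclideanSpace ℝ (Fin d) := fun ω =>
    (⟨fun x => V x ω, (hVg ω).continuous⟩, D ω)
  have hZ : Measurable Z := (measurable_path_iff.2 fun x => hVm x).prodMk hD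
  obtain ⟨κ, hM, hκ⟩ := exists_condLExp_kernel hm P hZ
  have hkey : ∀ (η : Ω → EuclideanSpace ℝ (Fin d)) (x : ℝ), Measurable[m] η →
      (fun ω => ∫⁻ θ, ENNReal.ofReal (payoff pathEval Prod.snd x (η ω) θ) ∂κ ω) =ᵐ[P]
        condLExp m P (fun ω => ENNReal.ofReal (V (x + inner ℝ (η ω) (D ω)) ω)) :=
    fun η x hη => hκ (fun a => ENNReal.ofReal (payoff pathEval Prod.snd x (η a.1) a.2))
      (measurable_payoff_pathEval hη x).ennreal_ofReal
  have hgen : ∀ (η : Ω → EuclideanSpace ℝ (Fin d)) (x : ℝ), Measurable[m] η →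
      (fun ω => eExp (κ ω) (payoff pathEval Prod.snd x (η ω))) =ᵐ[P]
        genCondExp m P (fun ω => V (x + inner ℝ (η ω) (D ω)) ω) := by
    intro η x hη
    have hneg := hκ (fun a => ENNReal.ofReal (-payoff pathEval Prod.snd x (η a.1) a.2))
      (measurable_payoff_pathEval hη x).neg.ennreal_ofReal
    filter_upwards [hkey η x hη, hneg] with ω h1 h2
    simp only [eExp, genCondExp]
    rw [h1, h2]
    rfl
  have hgood : ∀ᵐ ω ∂P, ∀ᵐ θ ∂κ ω, GoodPath U γ (pathEval θ) := by
    have hA : MeasurableSet {θ : C(ℝ, ℝ) × EuclideanSpace ℝ (Fin d) | GoodPath U γ θ.1} :=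
      measurable_fst (measurableSet_goodPath U γ)
    exact (ae_kernel_iff hm hκ hZ (A := Prod.snd ⁻¹' {θ | GoodPath U γ θ.1})
      (measurable_snd hA)).1 (Eventually.of_forall fun ω => hVg ω)
  -- Only countably many pairs `(R, ε)` occur, so one null set serves them all.
  have hint : ∀ᵐ ω ∂P, ∀ (R : ℕ) (ε : Fin d → Bool), ∫⁻ θ, ENNReal.ofReal
      (payoff pathEval Prod.snd R ((R : ℝ) • signVector ε) θ) ∂κ ω < ∞ := by
    refine ae_all_iff.2 fun R => ae_all_iff.2 fun ε => ?_
    filter_upwards [hkey (fun _ => (R : ℝ) • signVector ε) R measurable_const,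
      hfin R (fun _ => (R : ℝ) • signVector ε) measurable_const] with ω h1 h2
    exact lt_of_eq_of_lt h1 h2
  have harb : ∀ᵐ ω ∂P, ∀ p : EuclideanSpace ℝ (Fin d), (∀ᵐ θ ∂κ ω, 0 ≤ inner ℝ p θ.2) →
      ∀ᵐ θ ∂κ ω, inner ℝ p θ.2 = 0 := by
    -- The measurably selected candidate is an admissible strategy. Absence of arbitrage makes it
    -- ineffective, which rules out every arbitrage under almost every conditional law.
    obtain ⟨p, hpm, hp⟩ := exists_measurable_arbitrage κ
      (measurable_snd : Measurable fun θ : C(ℝ, ℝ) × EuclideanSpace ℝ (Fin d) => θ.2)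
    have hin := measurable_inner_snd_snd hpm
    have h1 : ∀ᵐ ω ∂P, 0 ≤ inner ℝ (p ω) (D ω) :=
      (ae_kernel_iff hm hκ hZ (A := {a | 0 ≤ inner ℝ (p a.1) a.2.2})
        (hin measurableSet_Ici)).2 (Eventually.of_forall fun ω => (hp ω).1)
    have h2 := (ae_kernel_iff hm hκ hZ (A := {a | inner ℝ (p a.1) a.2.2 = 0})
      (hin (measurableSet_singleton 0))).1 (hNA p hpm h1)
    filter_upwards [h2] with ω hω
    exact (hp ω).2 hω
  have hall : ∀ᵐ ω ∂P, OnePeriod U γ (κ ω) pathEval Prod.snd := by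
    filter_upwards [hgood, hint, harb] with ω h1 h2 h3
    exact ⟨measurable_pathEval, measurable_snd, h1,
      fun R => lintegral_norm_lt_top_of_signVector h1 (h2 R), h3⟩
  obtain ⟨N, hN, hNm, hN0⟩ := exists_measurable_superset_of_null (ae_iff.1 hall)
  have hB : ∀ ω ∈ Nᶜ, OnePeriod U γ (κ ω) pathEval Prod.snd := fun ω hω => by
    by_contra h
    exact hω (hN h)
  -- The exceptional null set can be removed `m`-measurably because `m` contains the null sets.
  have hB₀ : MeasurableSet[m] Nᶜ := (hnull N hNm hN0).compl
  obtain ⟨ξ, v, hξ, hv, hvg, hopt⟩ :=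
    exists_measurable_optimal hB₀ hB measurable_pathEval measurable_snd hγ hC hG hU
  have hae : ∀ᵐ ω ∂P, ω ∈ Nᶜ := measure_eq_zero_iff_ae_notMem.1 hN0
  refine ⟨ξ, v, hξ, hv, hvg, fun x => ⟨?_, fun η hη => ?_⟩⟩
  · have hξx : Measurable[m] (ξ x) := hξ.comp (measurable_const.prodMk measurable_id)
    filter_upwards [hgen (ξ x) x hξx, hae] with ω h1 h2
    rw [← h1, eExp_of_integrable (hopt ω h2 x).1.1, (hopt ω h2 x).2]
  · filter_upwards [hgen η x hη, hae] with ω h1 h2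
    rw [← h1]
    by_cases hI : Integrable (payoff pathEval Prod.snd x (η ω)) (κ ω)
    · rw [eExp_of_integrable hI, (hopt ω h2 x).2]
      exact EReal.coe_le_coe_iff.2 ((hopt ω h2 x).1.2 _ hI)
    · rw [eExp_eq_bot ((hB ω h2).measurable_payoff x _) ((hB ω h2).lintegral_payoff_lt_top x _) hI]
      exact bot_le

end OneStep

/-- A nonzero `U` is negative somewhere, by concavity at the midpoint `0` of `x` and `-x`; scaling a
negative value by `U (l * z) ≤ l * U z` gives unboundedness below. The zero function fails exactly
this. -/
theorem IsUtility.goodPath {U : ℝ → ℝ} {xt γ : ℝ} (hU : IsUtility U xt γ) (hne : ∃ x, U x ≠ 0) :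
    GoodPath U γ U := by
  refine ⟨hU.mono, hU.concave, fun _ => le_rfl, fun _ _ h => h, fun n => ?_⟩
  obtain ⟨z, hz⟩ : ∃ z, U z < 0 := by
    obtain ⟨x, hx⟩ := hne
    rcases hx.lt_or_gt with h | h
    · exact ⟨x, h⟩
    · have hc := hU.concave.2 (Set.mem_univ x) (Set.mem_univ (-x))
        (by norm_num : (0 : ℝ) ≤ 1 / 2) (by norm_num : (0 : ℝ) ≤ 1 / 2) (by norm_num)
      simp only [smul_eq_mul] at hc
      rw [show (1 / 2 : ℝ) * x + 1 / 2 * -x = 0 by ring, hU.zero] at hc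
      exact ⟨-x, by linarith⟩
  obtain ⟨k, hk⟩ := exists_nat_gt ((n : ℝ) / -U z)
  rw [div_lt_iff₀ (by linarith)] at hk
  obtain ⟨m, hm⟩ := exists_nat_ge (-((k + 1 : ℝ) * z))
  refine ⟨m, ?_⟩
  have h1 : U (-m) ≤ U ((k + 1) * z) := hU.mono (by linarith)
  have h2 := hU.le_mul (l := k + 1) (by simp) z
  linarith

/-! ### Backward induction over time. -/

variable {Ω : Type*} {d : ℕ}

theorem measurable_genCondExp {m : MeasurableSpace Ω} {mΩ : MeasurableSpace Ω} (P : Measure Ω)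
    (X : Ω → ℝ) : Measurable (genCondExp m P X) := by
  have h : ∀ Y : Ω → ℝ≥0∞, Measurable[mΩ] fun ω => ((condLExp m P Y ω : ℝ≥0∞) : EReal) := fun Y =>
    measurable_coe_ennreal_ereal.comp (measurable_condLExp' m P Y)
  exact (h _).sub (h _)

theorem genCondExp_zero {m : MeasurableSpace Ω} {_ : MeasurableSpace Ω} (P : Measure Ω) :
    genCondExp m P (fun _ => (0 : ℝ)) = fun _ => 0 := by
  have h : condLExp m P (fun _ => (0 : ℝ≥0∞)) = 0 := condLExp_zero P
  funext ω
  simp [genCondExp, h]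

variable [mΩ : MeasurableSpace Ω] {P : Measure Ω} {T : ℕ}
  {ℱ : Filtration ℕ mΩ} {S : ℕ → Ω → EuclideanSpace ℝ (Fin d)}

/-- Absence of arbitrage passes to every single period. -/
theorem NoArbitrage.one_period (hNA : NoArbitrage P ℱ S T) {t : ℕ} (ht : t < T)
    {η : Ω → EuclideanSpace ℝ (Fin d)} (hη : Measurable[ℱ t] η)
    (hpos : ∀ᵐ ω ∂P, 0 ≤ inner ℝ (η ω) (S (t + 1) ω - S t ω)) :
    ∀ᵐ ω ∂P, inner ℝ (η ω) (S (t + 1) ω - S t ω) = 0 := by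
  let φ : ℕ → Ω → EuclideanSpace ℝ (Fin d) := fun i => if i = t + 1 then η else fun _ => 0
  have hval : ∀ ω, portfolioValue S 0 φ T ω = inner ℝ (η ω) (S (t + 1) ω - S t ω) := by
    intro ω
    rw [portfolioValue, zero_add, Finset.sum_eq_single t]
    · simp [φ]
    · intro i _ hi
      simp [φ, hi]
    · intro h
      exact absurd (Finset.mem_range.2 ht) h
  have := hNA φ (fun i hi => by
    by_cases h : i = t
    · subst h; simpa [φ] using hη
    · simp [φ, h]) (by simpa only [hval] using hpos)
  simpa only [hval] using this

theorem isRegularValue_zero {U : ℝ → ℝ} (hU : ∀ x, U x = 0) :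
    IsRegularValue P ℱ S T U 0 (fun _ _ _ => 0) := by
  refine ⟨fun x _ => (hU x).symm, fun _ _ _ _ => measurable_const,
    fun _ _ _ => Eventually.of_forall fun _ => monotone_const,
    fun _ _ _ => Eventually.of_forall fun _ => concaveOn_const 0 convex_univ,
    fun t _ _ x => ⟨measurable_const, fun ξ => ?_, fun H _ hle => ?_⟩⟩
  · exact (Eventually.of_forall fun ω => (congrFun (genCondExp_zero P) ω).le)
  · have := hle ⟨fun _ => 0, measurable_const⟩
    filter_upwards [this] with ω hω
    exact (congrFun (genCondExp_zero (m := ℱ t) P) ω).ge.trans hω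

variable [IsProbabilityMeasure P]

/-- Well-posedness makes the conditional expectations of positive parts finite. -/
theorem ValueWellPosed.condLExp_lt_top {U : ℝ → ℝ} (hwp : ValueWellPosed P ℱ S T U) {t : ℕ}
    (ht : t < T) {u : ℕ → ℝ → Ω → ℝ} (hu : IsRegularValue P ℱ S T U (t + 1) u) (x : ℝ)
    {η : Ω → EuclideanSpace ℝ (Fin d)} (hη : Measurable[ℱ t] η) :
    ∀ᵐ ω ∂P, condLExp (ℱ t) P
      (fun ω => ENNReal.ofReal (nextValue S t (u (t + 1)) x η ω)) ω < ∞ := by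
  obtain ⟨G, hG⟩ := exists_isEssSupFamily P
    (f := fun ξ : {ξ : Ω → EuclideanSpace ℝ (Fin d) // Measurable[ℱ t] ξ} =>
      genCondExp (ℱ t) P (nextValue S t (u (t + 1)) x ξ.1)) fun ξ => measurable_genCondExp _ _
  filter_upwards [hwp.wellDefined t ht u hu x η hη, hwp.lt_top t ht u hu x G hG,
    hG.le ⟨η, hη⟩] with ω h1 h2 h3
  -- If the positive part had infinite conditional expectation, well-definedness would make the
  -- generalized one `⊤`, against the finite essential supremum.
  by_contra htop
  have h4 := h1.resolve_left htop
  rw [not_lt, top_le_iff] at htop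
  have h5 : genCondExp (ℱ t) P (nextValue S t (u (t + 1)) x η) ω = ⊤ := by
    rw [genCondExp, htop, EReal.coe_ennreal_top, sub_eq_add_neg]
    exact EReal.top_add_of_ne_bot (by simp [h4.ne])
  rw [h5] at h3
  exact absurd h2 (not_lt.2 h3)

/-- Regular value functions with good paths from time `s` on, and optimal positions. -/
structure BackwardSolution (P : Measure Ω) (ℱ : Filtration ℕ mΩ)
    (S : ℕ → Ω → EuclideanSpace ℝ (Fin d)) (T : ℕ) (U : ℝ → ℝ) (γ : ℝ) (s : ℕ)
    (u : ℕ → ℝ → Ω → ℝ) (ξ : ℕ → ℝ → Ω → EuclideanSpace ℝ (Fin d)) : Prop where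
  regular : IsRegularValue P ℱ S T U s u
  good : ∀ t, s ≤ t → t ≤ T → ∀ ω, GoodPath U γ fun x => u t x ω
  measurable : ∀ t, s ≤ t → t < T →
    Measurable[(borel ℝ).prod (ℱ t)] (fun p : ℝ × Ω => ξ (t + 1) p.1 p.2)
  optimal : ∀ t, s ≤ t → t < T → ∀ x, (fun ω => (u t x ω : EReal)) =ᵐ[P]
    genCondExp (ℱ t) P (nextValue S t (u (t + 1)) x (fun ω => ξ (t + 1) x ω))

theorem BackwardSolution.step (hnull : ∀ N : Set Ω, MeasurableSet N → P N = 0 →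
      MeasurableSet[ℱ 0] N) (hS : ∀ t ≤ T, Measurable[ℱ t] (S t)) {U : ℝ → ℝ} {γ : ℝ}
    (hγ : γ < 1) {C : ℝ} (hC : 0 < C) (hG : Growth γ C U) (hU : GoodPath U γ U)
    (hNA : NoArbitrage P ℱ S T) (hwp : ValueWellPosed P ℱ S T U) {s : ℕ} (hs : s < T)
    {u : ℕ → ℝ → Ω → ℝ} {ξ : ℕ → ℝ → Ω → EuclideanSpace ℝ (Fin d)}
    (h : BackwardSolution P ℱ S T U γ (s + 1) u ξ) :
    ∃ u' ξ', BackwardSolution P ℱ S T U γ s u' ξ' := by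
  obtain ⟨η, v, hη, hv, hvg, hopt⟩ := exists_one_step (ℱ.le s) P
    (fun N hN h0 => ℱ.mono (Nat.zero_le s) _ (hnull N hN h0)) hγ hC hG hU
    (V := u (s + 1)) (D := fun ω => S (s + 1) ω - S s ω)
    (fun x => (h.regular.adapted (s + 1) le_rfl hs x).mono (ℱ.le _) le_rfl)
    (h.good (s + 1) le_rfl hs)
    (((hS (s + 1) hs).mono (ℱ.le _) le_rfl).sub ((hS s hs.le).mono (ℱ.le _) le_rfl))
    (fun η hη hpos => hNA.one_period hs hη hpos)
    (fun x η hη => hwp.condLExp_lt_top hs h.regular x hη)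
  let u' := Function.update u s v
  let ξ' := Function.update ξ (s + 1) η
  have hu's : u' s = v := Function.update_self _ _ _
  have hu't : ∀ t, s + 1 ≤ t → u' t = u t := fun t ht => Function.update_of_ne (by omega) _ _
  have hξ's : ξ' (s + 1) = η := Function.update_self _ _ _
  have hξ't : ∀ t, s + 1 ≤ t → ξ' (t + 1) = ξ (t + 1) := fun t ht =>
    Function.update_of_ne (by omega) _ _
  have hcases : ∀ t, s ≤ t → t = s ∨ s + 1 ≤ t := fun t ht => by omega
  have hgood : ∀ t, s ≤ t → t ≤ T → ∀ ω, GoodPath U γ fun x => u' t x ω := by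
    intro t h1 h2 ω
    rcases hcases t h1 with rfl | h3
    · simpa only [hu's] using hvg ω
    · simpa only [hu't t h3] using h.good t h3 h2 ω
  have hoptimal : ∀ t, s ≤ t → t < T → ∀ x, (fun ω => (u' t x ω : EReal)) =ᵐ[P]
      genCondExp (ℱ t) P (nextValue S t (u' (t + 1)) x (fun ω => ξ' (t + 1) x ω)) := by
    intro t h1 h2 x
    rw [hu't (t + 1) (by omega)]
    rcases hcases t h1 with rfl | h3
    · rw [hu's, hξ's]
      exact (hopt x).1
    · rw [hu't t h3, hξ't t h3]
      exact h.optimal t h3 h2 x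
  refine ⟨u', ξ', ⟨?_, ?_, ?_, ?_, ?_⟩, hgood, ?_, hoptimal⟩
  · intro x ω
    rw [hu't T hs]
    exact h.regular.terminal x ω
  · intro t h1 h2 x
    rcases hcases t h1 with rfl | h3
    · rw [hu's]; exact hv x
    · rw [hu't t h3]; exact h.regular.adapted t h3 h2 x
  · exact fun t h1 h2 => Eventually.of_forall fun ω => (hgood t h1 h2 ω).mono
  · exact fun t h1 h2 => Eventually.of_forall fun ω => (hgood t h1 h2 ω).concave
  · intro t h1 h2 x
    rw [hu't (t + 1) (by omega)]
    rcases hcases t h1 with rfl | h3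
    · rw [hu's]
      refine ⟨measurable_coe_real_ereal.comp ((hv x).mono (ℱ.le _) le_rfl),
        fun ζ => (hopt x).2 ζ.1 ζ.2, fun H _ hle => ?_⟩
      -- The value is attained by an admissible position, so every upper bound of the family
      -- dominates it.
      have hηx : Measurable[ℱ t] (η x) := hη.comp (measurable_const.prodMk measurable_id)
      exact (hopt x).1.le.trans (hle ⟨η x, hηx⟩)
    · rw [hu't t h3]
      exact h.regular.bellman t h3 h2 x
  · intro t h1 h2
    rcases hcases t h1 with rfl | h3
    · rw [hξ's]; exact hη
    · rw [hξ't t h3]; exact h.measurable t h3 h2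

theorem exists_backwardSolution (hnull : ∀ N : Set Ω, MeasurableSet N → P N = 0 →
      MeasurableSet[ℱ 0] N) (hS : ∀ t ≤ T, Measurable[ℱ t] (S t)) {U : ℝ → ℝ} {γ : ℝ}
    (hγ : γ < 1) {C : ℝ} (hC : 0 < C) (hG : Growth γ C U) (hU : GoodPath U γ U)
    (hNA : NoArbitrage P ℱ S T) (hwp : ValueWellPosed P ℱ S T U) {s : ℕ} (hs : s ≤ T) :
    ∃ u ξ, BackwardSolution P ℱ S T U γ s u ξ := by
  induction hs using Nat.decreasingInduction with
  | self =>
    refine ⟨fun _ x _ => U x, fun _ _ _ => 0, ⟨fun _ _ => rfl, fun _ _ _ _ => measurable_const,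
      fun _ _ _ => Eventually.of_forall fun _ => hU.mono,
      fun _ _ _ => Eventually.of_forall fun _ => hU.concave, fun t h1 h2 => by omega⟩,
      fun _ _ _ _ => hU, fun t h1 h2 => by omega, fun t h1 h2 => by omega⟩
  | of_succ k hk ih =>
    obtain ⟨u, ξ, h⟩ := ih
    exact h.step hnull hS hγ hC hG hU hNA hwp hk

end UtilityMax

theorem proposition5p2 {Ω : Type*} [mΩ : MeasurableSpace Ω] (P : Measure Ω)
    [IsProbabilityMeasure P] (d T : ℕ) (ℱ : Filtration ℕ mΩ)
    (hnull : ∀ N : Set Ω, MeasurableSet N → P N = 0 → MeasurableSet[ℱ 0] N)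
    (S : ℕ → Ω → EuclideanSpace ℝ (Fin d)) (hS : ∀ t ≤ T, Measurable[ℱ t] (S t))
    (U : ℝ → ℝ) (xt γ : ℝ) (hU : UtilityMax.IsUtility U xt γ)
    (hNA : UtilityMax.NoArbitrage P ℱ S T)
    (hwp : UtilityMax.ValueWellPosed P ℱ S T U) :
    (∃ C : ℝ, 0 < C ∧ UtilityMax.Growth γ C U) ∧
    ∃ u : ℕ → ℝ → Ω → ℝ,
      UtilityMax.IsRegularValue P ℱ S T U 0 u ∧
      (∀ C : ℝ, 0 < C → UtilityMax.Growth γ C U →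
        ∀ t ≤ T, ∀ᵐ ω ∂P, UtilityMax.Growth γ C (fun x => u t x ω)) ∧
      (∀ t ≤ T, ∀ x, ⊥ < UtilityMax.eExp P (u t x)) ∧
      (∀ t ≤ T, ∀ x, ∀ᵐ ω ∂P, (u t x ω : EReal) < ⊤) ∧
      ∃ ξ : ℕ → ℝ → Ω → EuclideanSpace ℝ (Fin d), ∀ t < T,
        Measurable[(borel ℝ).prod (ℱ t)] (fun p : ℝ × Ω => ξ (t + 1) p.1 p.2) ∧
        ∀ x, (fun ω => (u t x ω : EReal)) =ᵐ[P]
          UtilityMax.genCondExp (ℱ t) P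
            (UtilityMax.nextValue S t (u (t + 1)) x (fun ω => ξ (t + 1) x ω)) := by
  obtain ⟨C, hC, hG⟩ := hU.exists_growth
  refine ⟨⟨C, hC, hG⟩, ?_⟩
  -- For `U = 0` the paths are not unbounded below, so zero values and zero positions are supplied
  -- directly.
  by_cases hne : ∃ x, U x ≠ 0
  · obtain ⟨u, ξ, h⟩ := UtilityMax.exists_backwardSolution hnull hS hU.γ_lt_one hC hG
      (hU.goodPath hne) hNA hwp (Nat.zero_le T)
    exact ⟨u, h.regular,
      fun C' hC' hG' t ht => Eventually.of_forall fun ω =>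
        (h.good t (Nat.zero_le t) ht ω).growth C' hC' hG',
      fun t ht x => UtilityMax.bot_lt_eExp_of_le fun ω => (h.good t (Nat.zero_le t) ht ω).ge x,
      fun t _ x => Eventually.of_forall fun ω => EReal.coe_lt_top _,
      ξ, fun t ht => ⟨h.measurable t (Nat.zero_le t) ht, h.optimal t (Nat.zero_le t) ht⟩⟩
  · push Not at hne
    refine ⟨fun _ _ _ => 0, UtilityMax.isRegularValue_zero hne, fun C' hC' _ t _ =>
      Eventually.of_forall fun ω x l hl => ?_, fun t _ x =>
      UtilityMax.bot_lt_eExp_of_le (c := 0) fun _ => le_rfl,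
      fun t _ x => Eventually.of_forall fun ω => EReal.coe_lt_top _, fun _ _ _ => 0,
      fun t _ => ⟨measurable_const, fun x => Eventually.of_forall fun ω =>
        (congrFun (UtilityMax.genCondExp_zero P) ω).symm⟩⟩
    have : 0 ≤ C' * l ^ γ := mul_nonneg hC'.le (Real.rpow_nonneg (by linarith) γ)
    simpa using this
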